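/- Let $d\ge 1$, $s>0$ and $1<p<\infty$. Let $D=\sqrt{-\Delta}$ and let $\dot H^s(\mathbb R^d)\cap L^p(\mathbb R^d)$ be the normed space of all complex-valued $u\in L^p(\mathbb R^d)$ with $D^su\in L^2(\mathbb R^d)$ (that is, the distributional Fourier transform $\hat u$ coincides on $\mathbb R^d\setminus\{0\}$ with a measurable function such that $|\xi|^s\hat u\in L^2$), with norm $\|u\|_{\dot H^s}+\|u\|_{L^p}$, where $\|u\|_{\dot H^s}=\|D^su\|_{L^2}$. Let $u_n\in\dot H^s(\mathbb R^d)\cap L^p(\mathbb R^d)$, $n\in\mathbb N$, be a sequence with $$\sup_n\left(\|u_n\|_{\dot H^s}+\|u_n\|_{L^p}\right)<\infty$$ and, for some $\eta>0$, $$\inf_n\left|\{x\in\mathbb R^d:\ |u_n(x)|>\eta\}\right|>0,$$ where $|\cdot|$ denotes Lebesgue measure. Then there is a sequence $(x_n)\subset\mathbb R^d$ such that a subsequence of $u_n(\cdot+x_n)$ converges weakly in $\dot H^s(\mathbb R^d)\cap L^p(\mathbb R^d)$ to a limit $u\not\equiv 0$. -/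

import Mathlib

open MeasureTheory Filter Topology
open scoped ENNReal SchwartzMap FourierTransform

noncomputable section

/-- For `u ∈ L^p(ℝ^d)` and `h ∈ L²(ℝ^d)`: the Fourier transform of `u` (a tempered distribution,
with the normalisation `e^{-2πi x·ξ}`) coincides on `ℝ^d ∖ {0}` with the function
`(2π|ξ|)^{-s} h(ξ)`, as tested against all `φ ∈ C_c^∞(ℝ^d ∖ {0})`. In other words,
`h = (2π|ξ|)^s û`, i.e. `h` is the Fourier transform of `D^s u`, where `D = √(-Δ)`. -/
def IsWeightedFourier {d : ℕ} (s : ℝ) {p : ℝ≥0∞} [Fact (1 ≤ p)]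
    (u : Lp ℂ p (volume : Measure (EuclideanSpace ℝ (Fin d))))
    (h : Lp ℂ 2 (volume : Measure (EuclideanSpace ℝ (Fin d)))) : Prop :=
  ∀ φ : 𝓢(EuclideanSpace ℝ (Fin d), ℂ), HasCompactSupport φ →
    (0 : EuclideanSpace ℝ (Fin d)) ∉ tsupport φ →
    (𝓕 (Lp.toTemperedDistribution u)) φ =
      ∫ ξ, (((2 * Real.pi * ‖ξ‖) ^ (-s) : ℝ) : ℂ) * φ ξ * h ξ

namespace IsWeightedFourier

variable {d : ℕ} {s : ℝ} {p : ℝ≥0∞} [Fact (1 ≤ p)]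
  {u u' : Lp ℂ p (volume : Measure (EuclideanSpace ℝ (Fin d)))}
  {h h' : Lp ℂ 2 (volume : Measure (EuclideanSpace ℝ (Fin d)))}

/-- The integrals that define `IsWeightedFourier` converge absolutely. -/
theorem integrable (s : ℝ) (h : Lp ℂ 2 (volume : Measure (EuclideanSpace ℝ (Fin d))))
    (φ : 𝓢(EuclideanSpace ℝ (Fin d), ℂ)) (hc : HasCompactSupport φ)
    (h0 : (0 : EuclideanSpace ℝ (Fin d)) ∉ tsupport φ) :
    Integrable (fun ξ => (((2 * Real.pi * ‖ξ‖) ^ (-s) : ℝ) : ℂ) * φ ξ * h ξ) volume := by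
  have hcont : Continuous
      (fun ξ : EuclideanSpace ℝ (Fin d) => (((2 * Real.pi * ‖ξ‖) ^ (-s) : ℝ) : ℂ) * φ ξ) := by
    apply continuous_of_tsupport
    intro x hx
    have hx' : x ∈ tsupport φ := closure_mono (Function.support_mul_subset_right _ _) hx
    have hx0 : x ≠ 0 := fun hx0 => h0 (hx0 ▸ hx')
    have hpos : 2 * Real.pi * ‖x‖ ≠ 0 := by
      have := norm_pos_iff.mpr hx0
      positivity
    refine ContinuousAt.mul ?_ φ.continuous.continuousAt
    refine Complex.continuous_ofReal.continuousAt.comp ?_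
    exact ContinuousAt.rpow_const (by fun_prop) (Or.inl hpos)
  have hm : MemLp
      (fun ξ : EuclideanSpace ℝ (Fin d) => (((2 * Real.pi * ‖ξ‖) ^ (-s) : ℝ) : ℂ) * φ ξ)
      2 volume :=
    hcont.memLp_of_hasCompactSupport hc.mul_left
  exact hm.integrable_mul (Lp.memLp h)

theorem add (hu : IsWeightedFourier s u h) (hu' : IsWeightedFourier s u' h') :
    IsWeightedFourier s (u + u') (h + h') := by
  intro φ hc h0
  have e : Lp.toTemperedDistribution (u + u') =
      Lp.toTemperedDistribution u + Lp.toTemperedDistribution u' := by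
    simp only [← Lp.toTemperedDistributionCLM_apply, map_add]
  rw [e, FourierTransform.fourier_add]
  change (𝓕 (Lp.toTemperedDistribution u)) φ + (𝓕 (Lp.toTemperedDistribution u')) φ = _
  rw [hu φ hc h0, hu' φ hc h0, ← integral_add (integrable s h φ hc h0) (integrable s h' φ hc h0)]
  refine integral_congr_ae ?_
  filter_upwards [Lp.coeFn_add h h'] with ξ hξ
  rw [hξ, Pi.add_apply]
  ring

theorem smul (c : ℂ) (hu : IsWeightedFourier s u h) :
    IsWeightedFourier s (c • u) (c • h) := by
  intro φ hc h0
  have e : Lp.toTemperedDistribution (c • u) = c • Lp.toTemperedDistribution u := by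
    simp only [← Lp.toTemperedDistributionCLM_apply, map_smul]
  rw [e, FourierTransform.fourier_smul]
  change c • (𝓕 (Lp.toTemperedDistribution u)) φ = _
  rw [hu φ hc h0, ← integral_smul]
  refine integral_congr_ae ?_
  filter_upwards [Lp.coeFn_smul c h] with ξ hξ
  rw [hξ, Pi.smul_apply]
  simp only [smul_eq_mul]
  ring

theorem zero : IsWeightedFourier s
    (0 : Lp ℂ p (volume : Measure (EuclideanSpace ℝ (Fin d)))) 0 := by
  have hz : IsWeightedFourier s
      ((0 : ℂ) • (0 : Lp ℂ p (volume : Measure (EuclideanSpace ℝ (Fin d)))))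
      ((0 : ℂ) • (0 : Lp ℂ 2 (volume : Measure (EuclideanSpace ℝ (Fin d))))) := by
    intro φ hc h0
    have e : Lp.toTemperedDistribution
        ((0 : ℂ) • (0 : Lp ℂ p (volume : Measure (EuclideanSpace ℝ (Fin d))))) = 0 := by
      simp only [← Lp.toTemperedDistributionCLM_apply, smul_zero, map_zero]
    rw [e, FourierTransform.fourier_zero, smul_zero]
    change (0 : ℂ) = _
    symm
    refine integral_eq_zero_of_ae ?_
    filter_upwards [Lp.coeFn_zero ℂ 2 (volume : Measure (EuclideanSpace ℝ (Fin d)))] with ξ hξ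
    rw [hξ]
    simp
  simpa using hz

/-- For `d ≥ 1` the function `h` is determined by `u`. -/
theorem unique [NeZero d] (hu : IsWeightedFourier s u h) (hu' : IsWeightedFourier s u h') :
    h = h' := by
  have hsub : IsWeightedFourier s (u + (-1 : ℂ) • u) (h + (-1 : ℂ) • h') := hu.add (hu'.smul (-1))
  have key : IsWeightedFourier s (0 : Lp ℂ p (volume : Measure (EuclideanSpace ℝ (Fin d))))
      (h - h') := by
    simpa [sub_eq_add_neg] using hsub
  have hloc : LocallyIntegrableOn
      (fun ξ => (((2 * Real.pi * ‖ξ‖) ^ (-s) : ℝ) : ℂ) * (h - h') ξ)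
      ({0}ᶜ : Set (EuclideanSpace ℝ (Fin d))) volume := by
    refine LocallyIntegrableOn.continuousOn_mul ?_ ?_ isOpen_compl_singleton.isLocallyClosed
    · exact ((Lp.memLp (h - h')).locallyIntegrable (by norm_num)).locallyIntegrableOn _
    · intro x hx
      have hpos : 2 * Real.pi * ‖x‖ ≠ 0 := by
        have := norm_pos_iff.mpr (show x ≠ 0 from hx)
        positivity
      refine ContinuousAt.continuousWithinAt ?_
      refine Complex.continuous_ofReal.continuousAt.comp ?_
      exact ContinuousAt.rpow_const (by fun_prop) (Or.inl hpos)
  have hz := isOpen_compl_singleton.ae_eq_zero_of_integral_contDiff_smul_eq_zero hloc (by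
    intro g hg hgc hgs
    have hgC : ContDiff ℝ (⊤ : ℕ∞) (fun x => (g x : ℂ)) :=
      Complex.ofRealCLM.contDiff.comp hg
    have hcC : HasCompactSupport (fun x => (g x : ℂ)) := hgc.comp_left (g := Complex.ofReal) rfl
    have hsupp : tsupport (fun x => (g x : ℂ)) ⊆ tsupport g :=
      closure_mono (fun x hx => by
        simp only [Function.mem_support, ne_eq, Complex.ofReal_eq_zero] at hx
        exact hx)
    have hk := key (hcC.toSchwartzMap hgC) hcC (fun h0 => hgs (hsupp h0) rfl)
    have e : Lp.toTemperedDistribution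
        (0 : Lp ℂ p (volume : Measure (EuclideanSpace ℝ (Fin d)))) = 0 := by
      simp only [← Lp.toTemperedDistributionCLM_apply, map_zero]
    rw [e, FourierTransform.fourier_zero] at hk
    change (0 : ℂ) = _ at hk
    rw [hk]
    refine integral_congr_ae (Eventually.of_forall fun ξ => ?_)
    have hgξ : (hcC.toSchwartzMap hgC) ξ = (g ξ : ℂ) := rfl
    simp only [Complex.real_smul, hgξ]
    ring)
  have h0 : ∀ᵐ x ∂(volume : Measure (EuclideanSpace ℝ (Fin d))), x ∈ ({0}ᶜ : Set _) := by
    rw [ae_iff]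
    simp
  have : h - h' = 0 := by
    refine Lp.ext ?_
    filter_upwards [hz, h0, Lp.coeFn_zero ℂ 2 (volume : Measure (EuclideanSpace ℝ (Fin d)))]
      with x hx hx0 hx1
    have hpos : 0 < 2 * Real.pi * ‖x‖ := by
      have := norm_pos_iff.mpr (show x ≠ 0 from hx0)
      positivity
    have hne : (((2 * Real.pi * ‖x‖) ^ (-s) : ℝ) : ℂ) ≠ 0 :=
      Complex.ofReal_ne_zero.mpr (Real.rpow_pos_of_pos hpos _).ne'
    rw [hx1]
    exact (mul_eq_zero.mp (hx hx0)).resolve_left hne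
  exact sub_eq_zero.mp this

end IsWeightedFourier

/-- The functions `u ∈ L^p(ℝ^d)` with `D^s u ∈ L²(ℝ^d)`, as a linear subspace of `L^p(ℝ^d)`. -/
def hdotLpSubmodule (d : ℕ) (s : ℝ) (p : ℝ≥0∞) [Fact (1 ≤ p)] :
    Submodule ℂ (Lp ℂ p (volume : Measure (EuclideanSpace ℝ (Fin d)))) where
  carrier := {u | ∃ h, IsWeightedFourier s u h}
  zero_mem' := ⟨0, IsWeightedFourier.zero⟩
  add_mem' := fun ⟨h, hu⟩ ⟨h', hu'⟩ => ⟨h + h', hu.add hu'⟩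
  smul_mem' := fun c _ ⟨h, hu⟩ => ⟨c • h, hu.smul c⟩

/-- The space `Ḣ^s(ℝ^d) ∩ L^p(ℝ^d)` of complex-valued functions. A type of its own, because its
norm (below) is not the one inherited from `L^p`. -/
def HdotLp (d : ℕ) (s : ℝ) (p : ℝ≥0∞) [Fact (1 ≤ p)] : Type :=
  hdotLpSubmodule d s p

namespace HdotLp

variable {d : ℕ} {s : ℝ} {p : ℝ≥0∞} [Fact (1 ≤ p)]

instance : AddCommGroup (HdotLp d s p) := inferInstanceAs (AddCommGroup (hdotLpSubmodule d s p))

instance : Module ℂ (HdotLp d s p) := inferInstanceAs (Module ℂ (hdotLpSubmodule d s p))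

/-- The inclusion `Ḣ^s ∩ L^p → L^p`. -/
def toLp : HdotLp d s p →ₗ[ℂ] Lp ℂ p (volume : Measure (EuclideanSpace ℝ (Fin d))) :=
  (hdotLpSubmodule d s p).subtype

theorem toLp_injective : Function.Injective (toLp : HdotLp d s p → _) :=
  Subtype.val_injective

/-- The function `(2π|ξ|)^s û ∈ L²(ℝ^d)`, i.e. the Fourier transform of `D^s u`. -/
def weightedFourier [NeZero d] :
    HdotLp d s p →ₗ[ℂ] Lp ℂ 2 (volume : Measure (EuclideanSpace ℝ (Fin d))) where
  toFun u := Classical.choose u.2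
  map_add' u v := (Classical.choose_spec (u + v).2).unique
    ((Classical.choose_spec u.2).add (Classical.choose_spec v.2))
  map_smul' c u := (Classical.choose_spec (c • u).2).unique
    ((Classical.choose_spec u.2).smul c)

theorem isWeightedFourier [NeZero d] (u : HdotLp d s p) :
    IsWeightedFourier s (toLp u) (weightedFourier u) :=
  Classical.choose_spec u.2

/-- The norm `‖u‖_{Ḣ^s} + ‖u‖_{L^p}`, where `‖u‖_{Ḣ^s} = ‖D^s u‖_{L²} = ‖(2π|ξ|)^s û‖_{L²}`. -/
def sumNorm [NeZero d] : AddGroupNorm (HdotLp d s p) where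
  toFun u := ‖weightedFourier u‖ + ‖toLp u‖
  map_zero' := by simp
  add_le' u v := by
    rw [map_add, map_add]
    linarith [norm_add_le (weightedFourier u) (weightedFourier v), norm_add_le (toLp u) (toLp v)]
  neg' u := by simp only [map_neg, norm_neg]
  eq_zero_of_map_eq_zero' u hu := by
    have h1 := norm_nonneg (weightedFourier u)
    have h2 := norm_nonneg (toLp u)
    have h3 : ‖toLp u‖ = 0 := by linarith
    exact toLp_injective (by rw [norm_eq_zero.mp h3, map_zero])

instance [NeZero d] : NormedAddCommGroup (HdotLp d s p) := sumNorm.toNormedAddCommGroup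

theorem norm_def [NeZero d] (u : HdotLp d s p) : ‖u‖ = ‖weightedFourier u‖ + ‖toLp u‖ := rfl

instance [NeZero d] : NormedSpace ℂ (HdotLp d s p) where
  norm_smul_le c u := by
    rw [norm_def, norm_def, map_smul, map_smul, norm_smul, norm_smul, mul_add]

end HdotLp

end

/-! ### Riesz representation and weak sequential compactness in `L^p` -/

section LpDuality

variable {α : Type*} [MeasurableSpace α] {μ : Measure α} {p q : ℝ≥0∞}

/-! Choose a smooth frequency cutoff `χ` equal to `1` on the ball of radius `R`, put `ρ = 𝓕⁻ χ`, and
write `u_n = ρ * u_n + w_n`. On the high frequencies the weight `|ξ|^s` is large, so `‖w_n‖_{L²} ≤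
(2πR)^{-s} ‖u_n‖_{Ḣ^s}`. By Chebyshev, for `R` large and independent of `n`, the set `{|w_n| ≥ η/2}`
is smaller than `{|u_n| > η}`; hence `|ρ * u_n| > η/2` at some point `x_n`. Now `(ρ * u_n)(x_n) = ∫
ρ(-y) u_n(y + x_n) dy` is one fixed continuous functional on `L^p` applied to the translate, so its
size survives in any weak limit, which therefore cannot vanish. No compact embedding is needed
(`IsWeightedFourier.exists_high_frequency`, `IsWeightedFourier.exists_lt_norm_integral`).

The translates stay bounded, since a translation multiplies `(2π|ξ|)^s û` by a unimodular character.
Weakly convergent subsequences are extracted in `L^p` and in `L²` separately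
(`exists_subseq_tendsto_weak_Lp`), from the duality of `L^p` and `L^q` and sequential
Banach–Alaoglu. The relation between `u` and its weighted Fourier transform passes to weak limits,
and by Hahn–Banach every functional on `Ḣ^s ∩ L^p` is a sum of functionals on the two components;
completeness of the space plays no role. -/

theorem tendsto_eLpNorm_sub_of_dominated {E ι : Type*} [NormedAddCommGroup E] {l : Filter ι}
    [l.IsCountablyGenerated] (hq0 : q ≠ 0) (hq : q ≠ ∞) {F : ι → α → E} {f b : α → E}
    (hF : ∀ i, AEStronglyMeasurable (F i) μ) (hf : AEStronglyMeasurable f μ)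
    (hb : MemLp b q μ) (hFb : ∀ i, ∀ᵐ a ∂μ, ‖F i a‖ ≤ ‖b a‖) (hfb : ∀ᵐ a ∂μ, ‖f a‖ ≤ ‖b a‖)
    (hlim : ∀ᵐ a ∂μ, Tendsto (fun i => F i a) l (𝓝 (f a))) :
    Tendsto (fun i => eLpNorm (F i - f) q μ) l (𝓝 0) := by
  have hqp : 0 < q.toReal := ENNReal.toReal_pos hq0 hq
  have key : Tendsto (fun i => ∫⁻ a, ‖(F i - f) a‖ₑ ^ q.toReal ∂μ) l (𝓝 (∫⁻ _, 0 ∂μ)) := by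
    refine tendsto_lintegral_filter_of_dominated_convergence'
      (fun a => (2 * ‖b a‖ₑ) ^ q.toReal) ?_ ?_ ?_ ?_
    · exact Eventually.of_forall fun i => (((hF i).sub hf).enorm).pow_const _
    · refine Eventually.of_forall fun i => ?_
      filter_upwards [hFb i, hfb] with a h1 h2
      refine ENNReal.rpow_le_rpow ?_ hqp.le
      calc ‖(F i - f) a‖ₑ ≤ ‖F i a‖ₑ + ‖f a‖ₑ := enorm_sub_le
        _ ≤ ‖b a‖ₑ + ‖b a‖ₑ :=
          add_le_add (enorm_le_iff_norm_le.mpr h1) (enorm_le_iff_norm_le.mpr h2)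
        _ = 2 * ‖b a‖ₑ := (two_mul _).symm
    · simp_rw [ENNReal.mul_rpow_of_nonneg _ _ hqp.le]
      rw [lintegral_const_mul' _ _ (by finiteness)]
      exact ENNReal.mul_ne_top (by finiteness)
        (lintegral_rpow_enorm_lt_top_of_eLpNorm_lt_top hq0 hq hb.2).ne
    · filter_upwards [hlim] with a ha
      have h1 : Tendsto (fun i => ‖F i a - f a‖ₑ) l (𝓝 0) := by
        have := (ha.sub_const (f a)).enorm
        simpa using this
      have := (ENNReal.continuous_rpow_const (y := q.toReal)).tendsto 0 |>.comp h1
      simpa [ENNReal.zero_rpow_of_pos hqp] using! this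
  simp_rw [eLpNorm_eq_lintegral_rpow_enorm_toReal hq0 hq]
  have := (ENNReal.continuous_rpow_const (y := 1 / q.toReal)).tendsto 0 |>.comp
    (by simpa using key)
  simpa [ENNReal.zero_rpow_of_pos (inv_pos.mpr hqp), Function.comp_def] using! this

theorem tendsto_toLp_of_dominated {E ι : Type*} [NormedAddCommGroup E] {l : Filter ι}
    [l.IsCountablyGenerated] [Fact (1 ≤ q)] (hq : q ≠ ∞) {F : ι → α → E} {f b : α → E}
    (hF : ∀ i, MemLp (F i) q μ) (hf : MemLp f q μ)
    (hb : MemLp b q μ) (hFb : ∀ i, ∀ᵐ a ∂μ, ‖F i a‖ ≤ ‖b a‖) (hfb : ∀ᵐ a ∂μ, ‖f a‖ ≤ ‖b a‖)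
    (hlim : ∀ᵐ a ∂μ, Tendsto (fun i => F i a) l (𝓝 (f a))) :
    Tendsto (fun i => (hF i).toLp) l (𝓝 hf.toLp) := by
  rw [Lp.tendsto_Lp_iff_tendsto_eLpNorm'']
  exact tendsto_eLpNorm_sub_of_dominated
    (zero_lt_one.trans_le (Fact.out : 1 ≤ q)).ne' hq (fun i => (hF i).1) hf.1 hb hFb hfb hlim

/-- Dominated convergence, with `w` itself as majorant. This yields the countable additivity of `A ↦
L (1_A w)`. -/
theorem hasSum_toLp_indicator [Fact (1 ≤ q)] (hq : q ≠ ∞) {w : α → ℂ} (hw : MemLp w q μ)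
    {A : ℕ → Set α} (hA : ∀ i, MeasurableSet (A i)) (hd : Pairwise (Function.onFun Disjoint A)) :
    HasSum (fun i => (hw.indicator (hA i)).toLp) (hw.indicator (MeasurableSet.iUnion hA)).toLp := by
  have hm : ∀ s : Finset ℕ, MemLp (fun x => ∑ i ∈ s, (A i).indicator w x) q μ := fun s =>
    memLp_finsetSum _ fun i _ => hw.indicator (hA i)
  have hs : ∀ s : Finset ℕ, ∑ i ∈ s, (hw.indicator (hA i)).toLp = (hm s).toLp := by
    classical
    intro s
    induction s using Finset.induction_on with
    | empty =>
      rw [Finset.sum_empty, ← MemLp.toLp_zero (MemLp.zero (ε := ℂ))]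
      exact MemLp.toLp_congr _ _ (by simp; rfl)
    | insert a s ha ih =>
      rw [Finset.sum_insert ha, ih, ← MemLp.toLp_add]
      refine MemLp.toLp_congr _ _ (Eventually.of_forall fun x => ?_)
      simp [Finset.sum_insert ha]
  unfold HasSum
  simp_rw [hs]
  have hpt : ∀ x, HasSum (fun i => (A i).indicator w x) ((⋃ i, A i).indicator w x) := by
    intro x
    by_cases hx : x ∈ ⋃ i, A i
    · obtain ⟨j, hj⟩ := Set.mem_iUnion.mp hx
      rw [Set.indicator_of_mem hx, ← Set.indicator_of_mem hj w]
      refine hasSum_single j fun i hi => Set.indicator_of_notMem (fun hxi => ?_) _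
      exact Set.disjoint_left.mp (hd hi) hxi hj
    · have h0 : ∀ i, (A i).indicator w x = 0 := fun i =>
        Set.indicator_of_notMem (fun hxi => hx (Set.mem_iUnion.mpr ⟨i, hxi⟩)) _
      simp_rw [h0, Set.indicator_of_notMem hx]
      exact hasSum_zero
  refine tendsto_toLp_of_dominated hq hm _ hw ?_ ?_ ?_
  · intro s
    refine Eventually.of_forall fun x => ?_
    rw [← Finset.indicator_biUnion_apply s A (fun i _ j _ hij => hd hij)]
    exact norm_indicator_le_norm_self _ _
  · exact Eventually.of_forall fun x => norm_indicator_le_norm_self _ _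
  · exact Eventually.of_forall fun x => hpt x

/-- Radon–Nikodym for the signed measure `A ↦ L (1_A w)`. The weight `w ∈ L^q` takes the place of
the constant `1`, which need not lie in `L^q` when `μ` is only σ-finite. -/
theorem exists_density_of_real_functional [SigmaFinite μ] [Fact (1 ≤ q)] (hq : q ≠ ∞) {w : α → ℂ}
    (hw : MemLp w q μ) (L : Lp ℂ q μ →L[ℝ] ℝ) :
    ∃ g : α → ℝ, Integrable g μ ∧
      ∀ A (hA : MeasurableSet A), L (hw.indicator hA).toLp = ∫ x in A, g x ∂μ := by
  classical
  let ν : SignedMeasure α :=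
    { measureOf' := fun A => if hA : MeasurableSet A then L (hw.indicator hA).toLp else 0
      empty' := by
        rw [dif_pos MeasurableSet.empty, ← map_zero L, ← MemLp.toLp_zero (MemLp.zero (ε := ℂ))]
        congr 1
        exact MemLp.toLp_congr _ _ (by simp; rfl)
      not_measurable' := fun A hA => dif_neg hA
      m_iUnion' := fun A hA hd => by
        simp_rw [dif_pos (hA _)]
        rw [dif_pos (MeasurableSet.iUnion hA)]
        exact (hasSum_toLp_indicator hq hw hA hd).mapL L }
  have hν : ∀ A (hA : MeasurableSet A), ν A = L (hw.indicator hA).toLp := fun A hA => dif_pos hA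
  have hac : ν ≪ᵥ μ.toENNRealVectorMeasure := by
    intro A hA0
    by_cases hA : MeasurableSet A
    · rw [Measure.toENNRealVectorMeasure_apply_measurable hA] at hA0
      rw [hν A hA, ← map_zero L, ← MemLp.toLp_zero (MemLp.zero (ε := ℂ))]
      congr 1
      exact MemLp.toLp_congr _ _ (indicator_meas_zero hA0)
    · exact ν.not_measurable hA
  refine ⟨ν.rnDeriv μ, SignedMeasure.integrable_rnDeriv _ _, fun A hA => ?_⟩
  rw [← hν A hA, ← withDensityᵥ_apply (SignedMeasure.integrable_rnDeriv _ _) hA,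
    SignedMeasure.withDensityᵥ_rnDeriv_eq ν μ hac]

theorem exists_density_of_functional [SigmaFinite μ] [Fact (1 ≤ q)] (hq : q ≠ ∞) {w : α → ℂ}
    (hw : MemLp w q μ) (L : Lp ℂ q μ →L[ℂ] ℂ) :
    ∃ g : α → ℂ, Integrable g μ ∧
      ∀ A (hA : MeasurableSet A), L (hw.indicator hA).toLp = ∫ x in A, g x ∂μ := by
  obtain ⟨g₁, hg₁, h₁⟩ :=
    exists_density_of_real_functional hq hw (Complex.reCLM ∘L L.restrictScalars ℝ)
  obtain ⟨g₂, hg₂, h₂⟩ :=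
    exists_density_of_real_functional hq hw (Complex.imCLM ∘L L.restrictScalars ℝ)
  have i₁ : Integrable (fun x => (g₁ x : ℂ)) μ := hg₁.ofReal
  have i₂ : Integrable (fun x => (g₂ x : ℂ) * Complex.I) μ := (hg₂.ofReal (𝕜 := ℂ)).mul_const _
  refine ⟨fun x => (g₁ x : ℂ) + (g₂ x : ℂ) * Complex.I, i₁.add i₂, fun A hA => ?_⟩
  rw [integral_add i₁.integrableOn i₂.integrableOn, integral_mul_const]
  have e₁ : (L (hw.indicator hA).toLp).re = _ := h₁ A hA
  have e₂ : (L (hw.indicator hA).toLp).im = _ := h₂ A hA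
  rw [integral_complex_ofReal, integral_complex_ofReal, ← e₁, ← e₂, Complex.re_add_im]

theorem memLp_bdd_mul {s w : α → ℂ} (hs : AEStronglyMeasurable s μ) {c : ℝ}
    (hc : ∀ x, ‖s x‖ ≤ c) (hw : MemLp w q μ) : MemLp (fun x => s x * w x) q μ :=
  hw.of_le_mul (c := c) (hs.mul hw.1) (Eventually.of_forall fun x => by
    rw [norm_mul]; gcongr; exact hc x)

theorem functional_simpleFunc_mul [Fact (1 ≤ q)] {w g : α → ℂ} (hw : MemLp w q μ)
    (L : Lp ℂ q μ →L[ℂ] ℂ) (hg : Integrable g μ)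
    (hL : ∀ A (hA : MeasurableSet A), L (hw.indicator hA).toLp = ∫ x in A, g x ∂μ)
    (s : SimpleFunc α ℂ) : ∀ h : MemLp (fun x => s x * w x) q μ,
      L h.toLp = ∫ x, s x * g x ∂μ := by
  have hbd : ∀ (t : SimpleFunc α ℂ), ∃ c, ∀ x, ‖t x‖ ≤ c := fun t => t.exists_forall_norm_le
  induction s using SimpleFunc.induction with
  | const c hA =>
    rename_i A
    intro h
    have e : h.toLp = c • (hw.indicator hA).toLp := by
      rw [← MemLp.toLp_const_smul]
      refine MemLp.toLp_congr _ _ (Eventually.of_forall fun x => ?_)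
      by_cases hx : x ∈ A <;> simp [hx]
    rw [e, map_smul, hL A hA, ← integral_smul, ← integral_indicator hA]
    refine integral_congr_ae (Eventually.of_forall fun x => ?_)
    by_cases hx : x ∈ A <;> simp [hx]
  | add hd hf hf' =>
    rename_i f f'
    intro h
    obtain ⟨c, hc⟩ := hbd f
    obtain ⟨c', hc'⟩ := hbd f'
    have m := memLp_bdd_mul f.stronglyMeasurable.aestronglyMeasurable hc hw
    have m' := memLp_bdd_mul f'.stronglyMeasurable.aestronglyMeasurable hc' hw
    have e : h.toLp = m.toLp + m'.toLp := by
      rw [← MemLp.toLp_add]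
      exact MemLp.toLp_congr _ _ (Eventually.of_forall fun x => by simp [add_mul])
    rw [e, map_add, hf m, hf' m', ← integral_add]
    · exact integral_congr_ae (Eventually.of_forall fun x => by simp [add_mul])
    · exact hg.bdd_mul f.stronglyMeasurable.aestronglyMeasurable (Eventually.of_forall hc)
    · exact hg.bdd_mul f'.stronglyMeasurable.aestronglyMeasurable (Eventually.of_forall hc')

theorem functional_bdd_mul [Fact (1 ≤ q)] (hq : q ≠ ∞) {w g : α → ℂ} (hw : MemLp w q μ)
    (L : Lp ℂ q μ →L[ℂ] ℂ) (hg : Integrable g μ)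
    (hL : ∀ A (hA : MeasurableSet A), L (hw.indicator hA).toLp = ∫ x in A, g x ∂μ)
    {s : α → ℂ} (hs : StronglyMeasurable s) {c : ℝ} (hc : ∀ x, ‖s x‖ ≤ c)
    (h : MemLp (fun x => s x * w x) q μ) :
    L h.toLp = ∫ x, s x * g x ∂μ := by
  -- On an empty space the bound `c` could be negative.
  rcases isEmpty_or_nonempty α with hα | ⟨⟨x₀⟩⟩
  · rw [show h.toLp = 0 from Lp.ext (Eventually.of_forall fun x => hα.elim x), map_zero]
    exact (integral_eq_zero_of_ae (Eventually.of_forall fun x => hα.elim x)).symm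
  have hc0 : 0 ≤ c := (norm_nonneg _).trans (hc x₀)
  have hbc : ∀ n x, ‖hs.approxBounded c n x‖ ≤ c := hs.norm_approxBounded_le hc0
  have hlim : ∀ x, Tendsto (fun n => hs.approxBounded c n x) atTop (𝓝 (s x)) := fun x =>
    hs.tendsto_approxBounded_of_norm_le (hc x)
  have hm : ∀ n, MemLp (fun x => hs.approxBounded c n x * w x) q μ := fun n =>
    memLp_bdd_mul (hs.approxBounded c n).stronglyMeasurable.aestronglyMeasurable (hbc n) hw
  have t1 : Tendsto (fun n => L (hm n).toLp) atTop (𝓝 (L h.toLp)) := by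
    refine (L.continuous.tendsto _).comp ?_
    refine tendsto_toLp_of_dominated hq hm h (hw.const_mul (c : ℂ)) ?_ ?_ ?_
    · intro n
      refine Eventually.of_forall fun x => ?_
      rw [norm_mul, norm_mul, Complex.norm_of_nonneg hc0]
      gcongr
      exact hbc n x
    · refine Eventually.of_forall fun x => ?_
      rw [norm_mul, norm_mul, Complex.norm_of_nonneg hc0]
      gcongr
      exact hc x
    · exact Eventually.of_forall fun x => (hlim x).mul_const _
  have t2 : Tendsto (fun n => ∫ x, hs.approxBounded c n x * g x ∂μ) atTop
      (𝓝 (∫ x, s x * g x ∂μ)) := by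
    refine tendsto_integral_of_dominated_convergence (fun x => c * ‖g x‖) ?_ ?_ ?_ ?_
    · exact fun n => (hs.approxBounded c n).stronglyMeasurable.aestronglyMeasurable.mul hg.1
    · exact hg.norm.const_mul c
    · intro n
      refine Eventually.of_forall fun x => ?_
      rw [norm_mul]
      gcongr
      exact hbc n x
    · exact Eventually.of_forall fun x => (hlim x).mul_const _
  refine tendsto_nhds_unique t1 (t2.congr fun n => ?_)
  exact (functional_simpleFunc_mul hw L hg hL _ (hm n)).symm

theorem exists_pos_memLp [SigmaFinite μ] (hq0 : q ≠ 0) (hq : q ≠ ∞) :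
    ∃ w : α → ℝ, Measurable w ∧ (∀ x, 0 < w x) ∧ MemLp (fun x => (w x : ℂ)) q μ := by
  obtain ⟨g, hg, hgm, hgi⟩ := exists_pos_lintegral_lt_of_sigmaFinite μ one_ne_zero
  have hqp : 0 < q.toReal := ENNReal.toReal_pos hq0 hq
  have hm : Measurable fun x => (g x : ℝ) ^ (1 / q.toReal) := hgm.coe_nnreal_real.pow_const _
  refine ⟨fun x => (g x : ℝ) ^ (1 / q.toReal), hm,
    fun x => Real.rpow_pos_of_pos (by exact_mod_cast hg x) _,
    (Complex.measurable_ofReal.comp hm).aestronglyMeasurable, ?_⟩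
  rw [eLpNorm_lt_top_iff_lintegral_rpow_enorm_lt_top hq0 hq]
  refine lt_of_le_of_lt (le_of_eq ?_) (hgi.trans ENNReal.one_lt_top)
  refine lintegral_congr fun x => ?_
  have : ‖(((g x : ℝ) ^ (1 / q.toReal) : ℝ) : ℂ)‖ₑ = (g x : ℝ≥0∞) ^ (1 / q.toReal) := by
    rw [← ofReal_norm, Complex.norm_of_nonneg (by positivity),
      ← ENNReal.ofReal_rpow_of_nonneg (by positivity) (by positivity), ENNReal.ofReal_coe_nnreal]
  rw [this, ← ENNReal.rpow_mul, one_div_mul_cancel hqp.ne', ENNReal.rpow_one]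

/-- At `z = 0` the exponent `p - 2` may be negative; the factor `conj z` makes the product vanish
all the same. -/
theorem norm_dual_mul {p : ℝ} (hp : 1 < p) (z : ℂ) :
    ‖((‖z‖ ^ (p - 2) : ℝ) : ℂ) * (starRingEnd ℂ) z‖ = ‖z‖ ^ (p - 1) := by
  rw [norm_mul, Complex.norm_of_nonneg (by positivity), RCLike.norm_conj]
  rcases eq_or_ne z 0 with rfl | hz
  · simp [Real.zero_rpow (sub_pos.mpr hp).ne']
  · rw [← Real.rpow_add_one (norm_ne_zero_iff.mpr hz)]
    congr 1
    ring

theorem dual_mul_self {p : ℝ} (hp : 1 < p) (z : ℂ) :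
    ((‖z‖ ^ (p - 2) : ℝ) : ℂ) * (starRingEnd ℂ) z * z = ((‖z‖ ^ p : ℝ) : ℂ) := by
  rw [mul_assoc, mul_comm (starRingEnd ℂ z), Complex.mul_conj']
  rcases eq_or_ne z 0 with rfl | hz
  · simp [Real.zero_rpow (by linarith : p ≠ 0)]
  · rw [← Complex.ofReal_pow, ← Complex.ofReal_mul, ← Real.rpow_two,
      ← Real.rpow_add (norm_pos_iff.mpr hz)]
    congr 2
    ring

/-- If a functional on `L^q` is represented by `G` on suitable truncations, then the truncations of
`G` are bounded in `L^p`. -/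
theorem eLpNorm_indicator_le_of_functional [Fact (1 ≤ q)] [hpq : p.HolderConjugate q]
    (hp : p ≠ ∞) (hq : q ≠ ∞) (L : Lp ℂ q μ →L[ℂ] ℂ) {G : α → ℂ} (hG : StronglyMeasurable G)
    {A : Set α} (hA : MeasurableSet A) {c : ℝ} (hc : ∀ x ∈ A, ‖G x‖ ≤ c)
    (hL : ∀ F : α → ℂ, StronglyMeasurable F → (∃ b, ∀ x, ‖F x‖ ≤ b) → (∀ x ∉ A, F x = 0) →
      Integrable (fun x => F x * G x) μ ∧
        ∃ h : MemLp F q μ, L h.toLp = ∫ x, F x * G x ∂μ) :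
    eLpNorm (A.indicator G) p μ ≤ ENNReal.ofReal ‖L‖ := by
  have hr : p.toReal.HolderConjugate q.toReal := ENNReal.HolderConjugate.toReal_of_ne_top hp hq
  set P := p.toReal
  set Q := q.toReal
  have hP1 : 1 < P := hr.lt
  -- The extremal function in Hölder's inequality: `F G = |G|^P = |F|^Q` on `A`.
  set F : α → ℂ := A.indicator fun x => ((‖G x‖ ^ (P - 2) : ℝ) : ℂ) * (starRingEnd ℂ) (G x)
  have hFm : StronglyMeasurable F := by
    refine StronglyMeasurable.indicator (Measurable.stronglyMeasurable ?_) hA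
    exact (Complex.measurable_ofReal.comp (hG.measurable.norm.pow_const _)).mul
      (Complex.continuous_conj.measurable.comp hG.measurable)
  have hFG : ∀ x, F x * G x = ((‖A.indicator G x‖ ^ P : ℝ) : ℂ) := by
    intro x
    by_cases hx : x ∈ A
    · simp only [F, Set.indicator_of_mem hx]
      exact dual_mul_self hP1 _
    · simp [F, Set.indicator_of_notMem hx, Real.zero_rpow (by linarith : P ≠ 0)]
  have hFn : ∀ x, ‖F x‖ ^ Q = ‖A.indicator G x‖ ^ P := by
    intro x
    by_cases hx : x ∈ A
    · simp only [F, Set.indicator_of_mem hx]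
      rw [norm_dual_mul hP1, ← Real.rpow_mul (norm_nonneg _), hr.sub_one_mul_conj]
    · simp [F, Set.indicator_of_notMem hx, Real.zero_rpow (by linarith : P ≠ 0),
        Real.zero_rpow hr.symm.ne_zero]
  obtain ⟨hi, hFq, hLF⟩ := hL F hFm ⟨|c| ^ (P - 1), fun x => by
    by_cases hx : x ∈ A
    · simp only [F, Set.indicator_of_mem hx]
      rw [norm_dual_mul hP1]
      exact Real.rpow_le_rpow (norm_nonneg _) ((hc x hx).trans (le_abs_self _)) (by linarith)
    · simp only [F, Set.indicator_of_notMem hx, norm_zero]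
      positivity⟩ (fun x hx => Set.indicator_of_notMem hx _)
  simp_rw [hFG] at hi hLF
  rw [integral_complex_ofReal] at hLF
  set I := ∫ x, ‖A.indicator G x‖ ^ P ∂μ
  have hI0 : 0 ≤ I := integral_nonneg fun x => by positivity
  have hGp : MemLp (A.indicator G) p μ := by
    rw [← integrable_norm_rpow_iff (hG.indicator hA).aestronglyMeasurable
      (ENNReal.HolderConjugate.ne_zero p q) hp]
    simpa using hi.re
  rw [hGp.eLpNorm_eq_integral_rpow_norm (ENNReal.HolderConjugate.ne_zero p q) hp]
  refine ENNReal.ofReal_le_ofReal ?_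
  -- Testing `L` on `F` gives this bound; dividing by `I ^ Q⁻¹`, legitimate because the truncation
  -- makes `I` a genuine finite integral, leaves `I ^ P⁻¹ ≤ ‖L‖`.
  have h1 : I ≤ ‖L‖ * I ^ Q⁻¹ := by
    have h2 := L.le_opNorm hFq.toLp
    rw [hLF, Complex.norm_of_nonneg hI0, Lp.norm_toLp,
      hFq.eLpNorm_eq_integral_rpow_norm (ENNReal.HolderConjugate.ne_zero q p) hq,
      ENNReal.toReal_ofReal (by positivity)] at h2
    change I ≤ ‖L‖ * (∫ x, ‖F x‖ ^ Q ∂μ) ^ Q⁻¹ at h2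
    simp_rw [hFn] at h2
    exact h2
  change I ^ P⁻¹ ≤ ‖L‖
  rcases hI0.eq_or_lt with h0 | hpos
  · rw [← h0, Real.zero_rpow (inv_ne_zero hr.ne_zero)]
    exact norm_nonneg _
  · have h3 : I = I ^ P⁻¹ * I ^ Q⁻¹ := by
      rw [← Real.rpow_add hpos, hr.inv_add_inv_eq_one, Real.rpow_one]
    have h4 : 0 < I ^ Q⁻¹ := Real.rpow_pos_of_pos hpos _
    exact le_of_mul_le_mul_right (h3 ▸ h1) h4

/-- For conjugate finite exponents, every continuous functional on `L^q` is integration against an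
element of `L^p`. -/
theorem exists_Lp_integral_eq [SigmaFinite μ] [Fact (1 ≤ q)] [hpq : p.HolderConjugate q]
    (hp : p ≠ ∞) (hq : q ≠ ∞) (L : Lp ℂ q μ →L[ℂ] ℂ) :
    ∃ G : Lp ℂ p μ, ∀ f : Lp ℂ q μ, L f = ∫ x, f x * G x ∂μ := by
  obtain ⟨w, hwm, hw0, hw⟩ := exists_pos_memLp (μ := μ) (ENNReal.HolderConjugate.ne_zero q p) hq
  obtain ⟨g₀, hg₀, hL₀⟩ := exists_density_of_functional hq hw L
  set g := hg₀.1.mk g₀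
  have hgm : StronglyMeasurable g := hg₀.1.stronglyMeasurable_mk
  have hg : Integrable g μ := hg₀.congr hg₀.1.ae_eq_mk
  have hL : ∀ A (hA : MeasurableSet A), L (hw.indicator hA).toLp = ∫ x in A, g x ∂μ :=
    fun A hA => (hL₀ A hA).trans (integral_congr_ae (ae_restrict_of_ae hg₀.1.ae_eq_mk))
  have hwC : Measurable fun x => (w x : ℂ) := Complex.measurable_ofReal.comp hwm
  have hwne : ∀ x, (w x : ℂ) ≠ 0 := fun x => Complex.ofReal_ne_zero.mpr (hw0 x).ne'
  set G : α → ℂ := fun x => g x / (w x : ℂ)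
  have hGm : StronglyMeasurable G := (hgm.measurable.div hwC).stronglyMeasurable
  -- On `A n` the weight is bounded below, so a bounded `F` supported there is `s w` with `s`
  -- bounded, and the representation by `g = G w` applies. Positivity of `w` makes these sets
  -- exhaust the space.
  set A : ℕ → Set α := fun n => {x | ‖G x‖ ≤ n ∧ ((n : ℝ) + 1)⁻¹ ≤ w x}
  have hA : ∀ n, MeasurableSet (A n) := fun n =>
    (measurableSet_le hGm.measurable.norm measurable_const).inter
      (measurableSet_le measurable_const hwm)
  have hAev : ∀ x, ∀ᶠ n in atTop, x ∈ A n := by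
    intro x
    have h1 : ∀ᶠ n : ℕ in atTop, ‖G x‖ ≤ n :=
      tendsto_natCast_atTop_atTop.eventually_ge_atTop _
    have h2 : ∀ᶠ n : ℕ in atTop, (w x)⁻¹ ≤ (n : ℝ) :=
      tendsto_natCast_atTop_atTop.eventually_ge_atTop _
    filter_upwards [h1, h2] with n hn1 hn2
    exact ⟨hn1, inv_le_of_inv_le₀ (hw0 x) (hn2.trans (by linarith))⟩
  have key : ∀ n, ∀ F : α → ℂ, StronglyMeasurable F → (∃ b, ∀ x, ‖F x‖ ≤ b) →
      (∀ x ∉ A n, F x = 0) → Integrable (fun x => F x * G x) μ ∧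
        ∃ h : MemLp F q μ, L h.toLp = ∫ x, F x * G x ∂μ := by
    rintro n F hF ⟨b, hb⟩ hFA
    set s : α → ℂ := fun x => F x / (w x : ℂ)
    have hs : StronglyMeasurable s := (hF.measurable.div hwC).stronglyMeasurable
    have hsb : ∀ x, ‖s x‖ ≤ |b| * (n + 1) := by
      intro x
      by_cases hx : x ∈ A n
      · rw [norm_div, Complex.norm_of_nonneg (hw0 x).le, div_eq_mul_inv]
        refine mul_le_mul ((hb x).trans (le_abs_self _)) ?_ (inv_nonneg.mpr (hw0 x).le)
          (abs_nonneg _)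
        exact inv_le_of_inv_le₀ (by positivity) hx.2
      · simp only [s, hFA x hx, zero_div, norm_zero]
        positivity
    have hsw : (fun x => s x * (w x : ℂ)) = F := funext fun x => div_mul_cancel₀ _ (hwne x)
    have hsg : (fun x => s x * g x) = fun x => F x * G x := funext fun x => by
      simp only [s, G]; ring
    have hm := memLp_bdd_mul hs.aestronglyMeasurable hsb hw
    have hrep := functional_bdd_mul hq hw L hg hL hs hsb hm
    have hi : Integrable (fun x => s x * g x) μ :=
      hg.bdd_mul hs.aestronglyMeasurable (Eventually.of_forall hsb)
    rw [hsg] at hi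
    simp_rw [hsg] at hrep
    refine ⟨hi, hsw ▸ hm, ?_⟩
    rw [← hrep]
    congr 1
    exact MemLp.toLp_congr _ _ (Eventually.of_forall fun x => (congrFun hsw x).symm)
  -- Fatou, from the bound `‖L‖` common to all truncations.
  have hGp : MemLp G p μ := by
    refine ⟨hGm.aestronglyMeasurable, lt_of_le_of_lt ?_ (ENNReal.ofReal_lt_top (r := ‖L‖))⟩
    refine (Lp.eLpNorm_lim_le_liminf_eLpNorm (f := fun n => (A n).indicator G)
      (fun n => (hGm.indicator (hA n)).aestronglyMeasurable) G ?_).trans ?_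
    · refine Eventually.of_forall fun x => tendsto_const_nhds.congr' ?_
      filter_upwards [hAev x] with n hn
      exact (Set.indicator_of_mem hn _).symm
    · refine liminf_le_of_le (by isBoundedDefault) fun b hb => ?_
      obtain ⟨n, hn⟩ := hb.exists
      exact hn.trans (eLpNorm_indicator_le_of_functional hp hq L hGm (hA n)
        (fun x hx => hx.1) (key n))
  refine ⟨hGp.toLp, fun f => ?_⟩
  have hfm : StronglyMeasurable f := Lp.stronglyMeasurable f
  have hfp : MemLp f q μ := Lp.memLp f
  set B : ℕ → Set α := fun n => A n ∩ {x | ‖f x‖ ≤ n}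
  have hB : ∀ n, MeasurableSet (B n) := fun n =>
    (hA n).inter (measurableSet_le hfm.measurable.norm measurable_const)
  have hBlim : ∀ x, Tendsto (fun n => (B n).indicator f x) atTop (𝓝 (f x)) := by
    intro x
    refine tendsto_const_nhds.congr' ?_
    have h1 : ∀ᶠ n : ℕ in atTop, ‖f x‖ ≤ n :=
      tendsto_natCast_atTop_atTop.eventually_ge_atTop _
    filter_upwards [hAev x, h1] with n hn hn1
    exact (Set.indicator_of_mem (show x ∈ B n from ⟨hn, hn1⟩) _).symm
  have hrep : ∀ n, L (hfp.indicator (hB n)).toLp = ∫ x, (B n).indicator f x * G x ∂μ := by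
    intro n
    have hbd : ∀ x, ‖(B n).indicator f x‖ ≤ n := fun x => by
      by_cases hx : x ∈ B n
      · rw [Set.indicator_of_mem hx]
        exact hx.2
      · simp [Set.indicator_of_notMem hx]
    obtain ⟨-, h, he⟩ := key n _ (hfm.indicator (hB n)) ⟨n, hbd⟩
      fun x hx => Set.indicator_of_notMem (fun h => hx h.1) _
    exact he
  have t1 : Tendsto (fun n => L (hfp.indicator (hB n)).toLp) atTop (𝓝 (L f)) := by
    have e : f = hfp.toLp := (Lp.toLp_coeFn f hfp).symm
    conv => enter [3]; rw [e]
    refine (L.continuous.tendsto _).comp (tendsto_toLp_of_dominated hq _ hfp hfp ?_ ?_ ?_)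
    · exact fun n => Eventually.of_forall fun x => norm_indicator_le_norm_self _ _
    · exact Eventually.of_forall fun x => le_rfl
    · exact Eventually.of_forall hBlim
  have t2 : Tendsto (fun n => ∫ x, (B n).indicator f x * G x ∂μ) atTop
      (𝓝 (∫ x, f x * G x ∂μ)) := by
    refine tendsto_integral_of_dominated_convergence (fun x => ‖f x * G x‖) ?_ ?_ ?_ ?_
    · exact fun n => ((hfm.indicator (hB n)).mul hGm).aestronglyMeasurable
    · have := hpq.symm
      exact (hfp.integrable_mul hGp).norm
    · refine fun n => Eventually.of_forall fun x => ?_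
      rw [norm_mul, norm_mul]
      gcongr
      exact norm_indicator_le_norm_self _ _
    · exact Eventually.of_forall fun x => (hBlim x).mul_const _
  rw [tendsto_nhds_unique t1 (t2.congr fun n => (hrep n).symm)]
  refine integral_congr_ae ?_
  filter_upwards [hGp.coeFn_toLp] with x hx
  rw [hx]

/-- Bounded sequences in `L^p`, `1 < p < ∞`, have weakly convergent subsequences. -/
theorem exists_subseq_tendsto_weak_Lp [SigmaFinite μ] [IsSeparable μ]
    [hp1 : Fact (1 ≤ p)] (hp : 1 < p) (hp' : p ≠ ∞) (f : ℕ → Lp ℂ p μ) {C : ℝ}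
    (hf : ∀ n, ‖f n‖ ≤ C) :
    ∃ g : Lp ℂ p μ, ∃ k : ℕ → ℕ, StrictMono k ∧
      ∀ L : Lp ℂ p μ →L[ℂ] ℂ, Tendsto (fun n => L (f (k n))) atTop (𝓝 (L g)) := by
  set q := ENNReal.conjExponent p
  have hpq : p.HolderConjugate q := ENNReal.HolderConjugate.conjExponent hp1.out
  have hqp : q.HolderConjugate p := hpq.symm
  have hq1 : Fact (1 ≤ q) := ⟨ENNReal.HolderConjugate.one_le q p⟩
  have hq : q ≠ ∞ := by
    have : p - 1 ≠ 0 := (tsub_pos_of_lt hp).ne'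
    simp [q, ENNReal.conjExponent, this]
  have : Fact (q ≠ ∞) := ⟨hq⟩
  let T : Lp ℂ p μ →L[ℂ] Lp ℂ q μ →L[ℂ] ℂ :=
    (ContinuousLinearMap.mul ℂ ℂ).lpPairing μ p q
  have hT : ∀ a b, T a b = ∫ x, a x * b x ∂μ := fun a b =>
    (ContinuousLinearMap.mul ℂ ℂ).lpPairing_eq_integral a b
  -- `L^q` is separable because `q` is finite, so closed balls of its dual are weak-* sequentially
  -- compact. The limit functional is then turned back into an element of `L^p`.
  obtain ⟨Λ, -, k, hk, hlim⟩ := WeakDual.isSeqCompact_closedBall ℂ (Lp ℂ q μ) 0 (‖T‖ * C)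
    (x := fun n => StrongDual.toWeakDual (T (f n))) (fun n => by
      simp only [Set.mem_preimage, Metric.mem_closedBall, dist_zero_right]
      refine (T.le_opNorm (f n)).trans ?_
      gcongr
      exact hf n)
  obtain ⟨g, hg⟩ := exists_Lp_integral_eq (p := p) (μ := μ) hp' hq (WeakDual.toStrongDual Λ)
  refine ⟨g, k, hk, fun L => ?_⟩
  obtain ⟨b, hb⟩ := exists_Lp_integral_eq (p := q) (μ := μ) hq hp' L
  have hLT : ∀ a, L a = T a b := fun a => by rw [hb, hT]
  simp_rw [hLT]
  rw [tendsto_iff_forall_eval_tendsto_topDualPairing] at hlim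
  have h1 := hlim b
  have h2 : T g b = (WeakDual.toStrongDual Λ) b := by
    rw [hg b, hT]
    exact integral_congr_ae (Eventually.of_forall fun x => mul_comm _ _)
  rw [h2]
  exact h1

end LpDuality

/-! ### Fourier uniqueness tested on compactly supported functions -/

section FourierAnalysis

variable {V : Type*} [NormedAddCommGroup V] [InnerProductSpace ℝ V] [FiniteDimensional ℝ V]
  [MeasurableSpace V] [BorelSpace V]

open scoped RealInnerProductSpace

namespace SchwartzMap

theorem fourier_compSubConstCLM_apply (φ : 𝓢(V, ℂ)) (a ξ : V) :
    𝓕 (compSubConstCLM ℂ a φ) ξ = Real.fourierChar (-⟪a, ξ⟫) • 𝓕 φ ξ := by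
  have h := congrFun (VectorFourier.fourierIntegral_comp_add_right Real.fourierChar
    (volume : Measure V) (innerₗ V) φ (-a)) ξ
  rw [fourier_coe, fourier_coe]
  change VectorFourier.fourierIntegral Real.fourierChar volume (innerₗ V) _ ξ = _
  refine Eq.trans ?_ (h.trans ?_)
  · congr 1
    ext x
    simp [sub_eq_add_neg]
  · simp
    rfl

/-- Multiplication of a Schwartz function by the character `ξ ↦ exp (2πi ⟪a, ξ⟫)`. -/
noncomputable def modulate (a : V) (φ : 𝓢(V, ℂ)) : 𝓢(V, ℂ) :=
  𝓕⁻ (compSubConstCLM ℂ a (𝓕 φ))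

theorem fourier_modulate_apply (a : V) (φ : 𝓢(V, ℂ)) (y : V) :
    𝓕 (modulate a φ) y = 𝓕 φ (y - a) := by
  rw [modulate, FourierTransform.fourier_fourierInv_eq, compSubConstCLM_apply]

theorem modulate_apply (a : V) (φ : 𝓢(V, ℂ)) (ξ : V) :
    modulate a φ ξ = Real.fourierChar ⟪a, ξ⟫ • φ ξ := by
  have h : ∀ (f : 𝓢(V, ℂ)) (y : V), 𝓕⁻ f y = 𝓕 f (-y) := fun f y => by
    rw [fourierInv_coe, fourier_coe, Real.fourierInv_eq_fourier_neg]
  rw [modulate, h, fourier_compSubConstCLM_apply, ← h, FourierTransform.fourierInv_fourier_eq]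
  simp

/-- The multiplication formula `∫ 𝓕φ · g = ∫ φ · 𝓕g` for `g` the translate of `𝓕⁻ χ` by `y`, whose
transform is `χ` times a character. -/
theorem fourier_mul_apply (χ φ : 𝓢(V, ℂ)) (y : V) :
    𝓕 (pairing (ContinuousLinearMap.mul ℂ ℂ) χ φ) y = ∫ x, (𝓕⁻ χ) (x - y) * 𝓕 φ x := by
  have h := integral_fourier_mul_eq φ (compSubConstCLM ℂ y (𝓕⁻ χ))
  simp only [compSubConstCLM_apply] at h
  simp_rw [mul_comm ((𝓕⁻ χ) _)]
  rw [h, fourier_coe, Real.fourier_eq]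
  refine integral_congr_ae (Eventually.of_forall fun x => ?_)
  simp only [fourier_compSubConstCLM_apply, FourierTransform.fourier_fourierInv_eq,
    pairing_apply_apply, ContinuousLinearMap.mul_apply', real_inner_comm x y]
  rw [mul_smul_comm, mul_comm]

end SchwartzMap

/-- Every test function is the transform of a Schwartz function, so the multiplication formula moves
the transform onto `g`. -/
theorem ae_eq_zero_of_fourier_eq_zero {g : V → ℂ} (hg : Integrable g) (h : ∀ ξ, 𝓕 g ξ = 0) :
    g =ᵐ[volume] 0 := by
  refine ae_eq_zero_of_integral_contDiff_smul_eq_zero hg.locallyIntegrable fun η hη hηc => ?_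
  have hηC : ContDiff ℝ (⊤ : ℕ∞) (fun x => (η x : ℂ)) := Complex.ofRealCLM.contDiff.comp hη
  have hcC : HasCompactSupport (fun x => (η x : ℂ)) := hηc.comp_left (g := Complex.ofReal) rfl
  set f : 𝓢(V, ℂ) := hcC.toSchwartzMap hηC
  have h1 := VectorFourier.integral_fourierIntegral_smul_eq_flip (L := innerₗ V) (μ := volume)
    (ν := volume) Real.continuous_fourierChar continuous_inner hg (𝓕⁻ f).integrable
  have h2 : ∀ x, VectorFourier.fourierIntegral Real.fourierChar volume (innerₗ V).flip
      (𝓕⁻ f : 𝓢(V, ℂ)) x = f x := by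
    intro x
    rw [flip_innerₗ]
    change 𝓕 ((𝓕⁻ f : 𝓢(V, ℂ)) : V → ℂ) x = f x
    rw [← SchwartzMap.fourier_coe, FourierTransform.fourier_fourierInv_eq]
  simp_rw [h2] at h1
  have h3 : ∀ ξ, VectorFourier.fourierIntegral Real.fourierChar volume (innerₗ V) g ξ = 0 := h
  simp_rw [h3, zero_smul, integral_zero] at h1
  rw [h1]
  refine integral_congr_ae (Eventually.of_forall fun x => ?_)
  simp only [Complex.real_smul, smul_eq_mul]
  rw [mul_comm]
  rfl

theorem hasCompactSupport_compSubConstCLM {W : Type*} [NormedAddCommGroup W] [NormedSpace ℝ W]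
    {φ : 𝓢(W, ℂ)} (hφ : HasCompactSupport φ) (a : W) :
    HasCompactSupport (SchwartzMap.compSubConstCLM ℂ a φ) := by
  have : (SchwartzMap.compSubConstCLM ℂ a φ : W → ℂ) = φ ∘ (Homeomorph.subRight a) := by
    ext x; simp
  rw [this]
  exact hφ.comp_homeomorph _

theorem exists_fourier_ne_zero (x₀ : V) :
    ∃ φ : 𝓢(V, ℂ), HasCompactSupport φ ∧ 𝓕 φ x₀ ≠ 0 := by
  let b : ContDiffBump (0 : V) := ⟨1, 2, one_pos, one_lt_two⟩
  have hbC : ContDiff ℝ (⊤ : ℕ∞) (fun x => (b x : ℂ)) := Complex.ofRealCLM.contDiff.comp b.contDiff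
  have hcC : HasCompactSupport (fun x => (b x : ℂ)) :=
    b.hasCompactSupport.comp_left (g := Complex.ofReal) rfl
  set f : 𝓢(V, ℂ) := hcC.toSchwartzMap hbC
  -- Modulation shifts the transform, so its value at `x₀` is the integral of the bump.
  refine ⟨SchwartzMap.modulate x₀ f, ?_, ?_⟩
  · refine hcC.mono fun x hx => ?_
    rw [Function.mem_support, SchwartzMap.modulate_apply] at hx
    exact fun h0 => hx (by rw [show f x = 0 from h0, smul_zero])
  · rw [SchwartzMap.fourier_modulate_apply, sub_self, SchwartzMap.fourier_coe, Real.fourier_eq]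
    simp only [inner_zero_right, neg_zero, AddChar.map_zero_eq_one, one_smul]
    have : ∫ v, f v = ((∫ v, b v : ℝ) : ℂ) := integral_complex_ofReal
    rw [this]
    exact Complex.ofReal_ne_zero.mpr (b.integral_pos (μ := volume)).ne'

/-- A function is determined by its distributional Fourier transform, tested against compactly
supported smooth functions. -/
theorem ae_eq_zero_of_integral_fourier_mul_eq_zero {G : V → ℂ}
    (hi : ∀ φ : 𝓢(V, ℂ), Integrable fun x => 𝓕 φ x * G x)
    (h0 : ∀ φ : 𝓢(V, ℂ), HasCompactSupport φ → ∫ x, 𝓕 φ x * G x = 0) :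
    G =ᵐ[volume] 0 := by
  -- Translating `φ` by `a` multiplies `𝓕 φ` by a character and keeps the support compact, so `h0`
  -- says that the integrable function `𝓕 φ · G` has zero Fourier transform.
  have key : ∀ φ : 𝓢(V, ℂ), HasCompactSupport φ → (fun x => 𝓕 φ x * G x) =ᵐ[volume] 0 := by
    intro φ hφ
    refine ae_eq_zero_of_fourier_eq_zero (hi φ) fun a => ?_
    rw [Real.fourier_eq, ← h0 _ (hasCompactSupport_compSubConstCLM hφ a)]
    refine integral_congr_ae (Eventually.of_forall fun x => ?_)
    simp only [SchwartzMap.fourier_compSubConstCLM_apply, smul_mul_assoc, real_inner_comm a x]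
  refine measure_null_of_locally_null _ fun x₀ _ => ?_
  obtain ⟨φ, hφ, hne⟩ := exists_fourier_ne_zero x₀
  have hopen : ∀ᶠ x in 𝓝 x₀, 𝓕 φ x ≠ 0 :=
    (𝓕 φ).continuous.continuousAt.eventually_ne hne
  refine ⟨{x | 𝓕 φ x ≠ 0} ∩ {x | G x ≠ 0}, ?_, ?_⟩
  · exact inter_mem (mem_nhdsWithin_of_mem_nhds hopen) self_mem_nhdsWithin
  · refine measure_mono_null ?_ (ae_iff.mp (key φ hφ))
    rintro x ⟨h1, h2⟩
    exact mul_ne_zero h1 h2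

end FourierAnalysis

/-! ### Convolution of `L^p` functions with Schwartz functions -/

section Convolution

variable {V : Type*} [NormedAddCommGroup V] [InnerProductSpace ℝ V] [FiniteDimensional ℝ V]
  [MeasurableSpace V] [BorelSpace V] {p : ℝ≥0∞}

theorem lintegral_enorm_sub_mul_le [hp : Fact (1 ≤ p)] (ρ : 𝓢(V, ℂ)) {u : V → ℂ}
    (hu : MemLp u p volume) (x : V) :
    ∫⁻ y, ‖ρ (x - y) * u y‖ₑ ≤ eLpNorm ρ p.conjExponent volume * eLpNorm u p volume := by
  have hpq : p.HolderConjugate p.conjExponent := ENNReal.HolderConjugate.conjExponent hp.out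
  have := hpq.symm
  have hmp : MeasurePreserving (fun y : V => x - y) volume volume :=
    Measure.measurePreserving_sub_left volume x
  have hρ : AEStronglyMeasurable ρ (volume : Measure V) := ρ.continuous.aestronglyMeasurable
  have h1 : eLpNorm (fun y => ρ (x - y) * u y) 1 volume ≤
      eLpNorm (fun y => ρ (x - y)) p.conjExponent volume * eLpNorm u p volume :=
    eLpNorm_smul_le_mul_eLpNorm (φ := fun y => ρ (x - y)) (p := p.conjExponent) (q := p) (r := 1)
      hu.1 (hρ.comp_measurePreserving hmp)
  have h2 : eLpNorm (fun y => ρ (x - y)) p.conjExponent volume =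
      eLpNorm ρ p.conjExponent volume := eLpNorm_comp_measurePreserving hρ hmp
  rwa [h2, eLpNorm_one_eq_lintegral_enorm] at h1

theorem aestronglyMeasurable_mul_sub_mul (ψ ρ : 𝓢(V, ℂ)) {u : V → ℂ}
    (hu : AEStronglyMeasurable u volume) :
    AEStronglyMeasurable (fun z : V × V => ψ z.1 * (ρ (z.1 - z.2) * u z.2))
      ((volume : Measure V).prod volume) := by
  have h1 : Continuous fun z : V × V => ψ z.1 := ψ.continuous.comp continuous_fst
  have h2 : Continuous fun z : V × V => ρ (z.1 - z.2) :=
    ρ.continuous.comp (continuous_fst.sub continuous_snd)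
  exact h1.aestronglyMeasurable.mul (h2.aestronglyMeasurable.mul hu.comp_snd)

/-- Hölder bounds the inner integral uniformly in `x`, and `ψ` is integrable; this licenses Fubini.
-/
theorem integrable_mul_sub_mul [hp : Fact (1 ≤ p)] (ψ ρ : 𝓢(V, ℂ)) {u : V → ℂ}
    (hu : MemLp u p volume) :
    Integrable (fun z : V × V => ψ z.1 * (ρ (z.1 - z.2) * u z.2))
      ((volume : Measure V).prod volume) := by
  have hm := aestronglyMeasurable_mul_sub_mul ψ ρ hu.1
  refine ⟨hm, ?_⟩
  have hq : eLpNorm ρ p.conjExponent volume < ∞ := ρ.eLpNorm_lt_top _ _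
  rw [HasFiniteIntegral, lintegral_prod _ hm.enorm]
  calc ∫⁻ x, ∫⁻ y, ‖ψ x * (ρ (x - y) * u y)‖ₑ
      ≤ ∫⁻ x, ‖ψ x‖ₑ * (eLpNorm ρ p.conjExponent volume * eLpNorm u p volume) := by
        refine lintegral_mono fun x => ?_
        simp_rw [enorm_mul (ψ x)]
        rw [lintegral_const_mul' _ _ enorm_ne_top]
        gcongr
        exact lintegral_enorm_sub_mul_le ρ hu x
    _ < ∞ := by
        rw [lintegral_mul_const' _ _ (ENNReal.mul_ne_top hq.ne hu.2.ne)]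
        exact ENNReal.mul_lt_top (ψ.integrable (μ := volume)).2 (ENNReal.mul_lt_top hq hu.2)

theorem integral_mul_integral_sub_mul [hp : Fact (1 ≤ p)] (ψ ρ : 𝓢(V, ℂ)) {u : V → ℂ}
    (hu : MemLp u p volume) :
    ∫ x, ψ x * ∫ y, ρ (x - y) * u y = ∫ y, (∫ x, ρ (x - y) * ψ x) * u y := by
  simp_rw [← integral_const_mul, ← integral_mul_const]
  rw [integral_integral_swap (integrable_mul_sub_mul ψ ρ hu)]
  congr 1
  ext y
  congr 1
  ext x
  ring

end Convolution

/-! ### Low and high frequencies -/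

section Decomposition

open scoped RealInnerProductSpace

variable {d : ℕ} {s : ℝ} {p : ℝ≥0∞} [Fact (1 ≤ p)]
  {u : Lp ℂ p (volume : Measure (EuclideanSpace ℝ (Fin d)))}
  {h : Lp ℂ 2 (volume : Measure (EuclideanSpace ℝ (Fin d)))}

theorem norm_toLp_mul_le {α : Type*} [MeasurableSpace α] {μ : Measure α} {q : ℝ≥0∞} {m : α → ℂ}
    {f : Lp ℂ q μ} {c : ℝ} (hm : ∀ x, ‖m x‖ ≤ c) (hmf : MemLp (fun x => m x * f x) q μ) :
    ‖hmf.toLp‖ ≤ c * ‖f‖ := by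
  refine Lp.norm_le_mul_norm_of_ae_le_mul ?_
  filter_upwards [hmf.coeFn_toLp] with x hx
  rw [hx, norm_mul]
  gcongr
  exact hm x

theorem exists_cutoff {V : Type*} [NormedAddCommGroup V] [InnerProductSpace ℝ V]
    [FiniteDimensional ℝ V] {R : ℝ} (hR : 0 < R) :
    ∃ χ : 𝓢(V, ℂ), (∀ x, ‖x‖ ≤ R → χ x = 1) ∧ ∀ x, ‖1 - χ x‖ ≤ 1 := by
  let b : ContDiffBump (0 : V) := ⟨R, 2 * R, hR, by linarith⟩
  have hbC : ContDiff ℝ (⊤ : ℕ∞) (fun x => (b x : ℂ)) := Complex.ofRealCLM.contDiff.comp b.contDiff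
  have hcC : HasCompactSupport (fun x => (b x : ℂ)) :=
    b.hasCompactSupport.comp_left (g := Complex.ofReal) rfl
  refine ⟨hcC.toSchwartzMap hbC, fun x hx => ?_, fun x => ?_⟩
  · change (b x : ℂ) = 1
    rw [b.one_of_mem_closedBall (by simpa using hx), Complex.ofReal_one]
  · change ‖1 - (b x : ℂ)‖ ≤ 1
    rw [← Complex.ofReal_one, ← Complex.ofReal_sub, Complex.norm_of_nonneg (by
      have := b.le_one (x := x); linarith)]
    have := b.nonneg (x := x)
    linarith

/-- Splitting into low and high frequencies: `u = ρ * u + w` with `w` small in `L²`. -/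
theorem IsWeightedFourier.exists_high_frequency (hu : IsWeightedFourier s u h) (hs : 0 < s)
    {R : ℝ} (hR : 0 < R) {χ : 𝓢(EuclideanSpace ℝ (Fin d), ℂ)} (hχ : ∀ x, ‖x‖ ≤ R → χ x = 1)
    (hχ1 : ∀ x, ‖1 - χ x‖ ≤ 1) :
    ∃ w : Lp ℂ 2 (volume : Measure (EuclideanSpace ℝ (Fin d))),
      ‖w‖ ≤ (2 * Real.pi * R) ^ (-s) * ‖h‖ ∧
      ∀ᵐ x, u x = w x + ∫ y, (𝓕⁻ χ) (x - y) * u y := by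
  -- The multiplier taking `h` to the transform of the high-frequency part. It vanishes for `|ξ| ≤
  -- R`, hence also near the origin, where nothing is known about `û`.
  set m : EuclideanSpace ℝ (Fin d) → ℂ :=
    fun ξ => (1 - χ ξ) * (((2 * Real.pi * ‖ξ‖) ^ (-s) : ℝ) : ℂ)
  have hmb : ∀ ξ, ‖m ξ‖ ≤ (2 * Real.pi * R) ^ (-s) := by
    intro ξ
    rcases le_or_gt ‖ξ‖ R with hξ | hξ
    · simp only [m, hχ ξ hξ, sub_self, zero_mul, norm_zero]
      positivity
    · rw [norm_mul, Complex.norm_of_nonneg (by positivity)]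
      refine (mul_le_of_le_one_left (by positivity) (hχ1 ξ)).trans ?_
      exact Real.rpow_le_rpow_of_nonpos (by positivity) (by gcongr) (by linarith)
  have hmm : Measurable m := by
    refine (measurable_const.sub χ.continuous.measurable).mul ?_
    exact Complex.measurable_ofReal.comp ((measurable_const.mul measurable_norm).pow_const _)
  have hmh : MemLp (fun ξ => m ξ * h ξ) 2 volume :=
    memLp_bdd_mul hmm.aestronglyMeasurable hmb (Lp.memLp h)
  set w : Lp ℂ 2 (volume : Measure (EuclideanSpace ℝ (Fin d))) := 𝓕⁻ hmh.toLp
  refine ⟨w, ?_, ?_⟩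
  · have : ‖w‖ = ‖hmh.toLp‖ := by
      rw [← Lp.norm_fourier_eq w, FourierTransform.fourier_fourierInv_eq]
    rw [this]
    exact norm_toLp_mul_le hmb hmh
  set K : EuclideanSpace ℝ (Fin d) → ℂ := fun x => ∫ y, (𝓕⁻ χ) (x - y) * u y
  have hiu : ∀ ψ : 𝓢(EuclideanSpace ℝ (Fin d), ℂ), Integrable fun x => ψ x * u x := fun ψ => by
    have : p.HolderConjugate p.conjExponent :=
      ENNReal.HolderConjugate.conjExponent (Fact.out : 1 ≤ p)
    have := this.symm
    exact (ψ.memLp p.conjExponent).integrable_mul (Lp.memLp u)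
  have hiw : ∀ ψ : 𝓢(EuclideanSpace ℝ (Fin d), ℂ), Integrable fun x => ψ x * w x := fun ψ =>
    (ψ.memLp 2).integrable_mul (Lp.memLp w)
  have hiK : ∀ ψ : 𝓢(EuclideanSpace ℝ (Fin d), ℂ), Integrable fun x => ψ x * K x := fun ψ => by
    have := (integrable_mul_sub_mul ψ (𝓕⁻ χ) (Lp.memLp u)).integral_prod_left
    simpa only [integral_const_mul] using this
  have hz := ae_eq_zero_of_integral_fourier_mul_eq_zero (G := fun x => u x - w x - K x)
    (fun φ => by
      simp_rw [mul_sub]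
      exact ((hiu _).sub (hiw _)).sub (hiK _)) (fun φ hφ => by
    simp_rw [mul_sub]
    have hsub := integral_sub ((hiu (𝓕 φ)).sub (hiw (𝓕 φ))) (hiK (𝓕 φ))
    simp only [Pi.sub_apply] at hsub
    rw [hsub, integral_sub (hiu _) (hiw _)]
    set χφ := SchwartzMap.pairing (ContinuousLinearMap.mul ℂ ℂ) χ φ
    have hχφ : ∀ ξ, χφ ξ = χ ξ * φ ξ := fun ξ => rfl
    have hK : ∫ x, 𝓕 φ x * K x = ∫ x, 𝓕 χφ x * u x := by
      rw [integral_mul_integral_sub_mul _ _ (Lp.memLp u)]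
      simp_rw [χφ, SchwartzMap.fourier_mul_apply]
    have hw : ∫ x, 𝓕 φ x * w x = ∫ ξ, φ ξ * (m ξ * h ξ) := by
      have h1 : (𝓕 (Lp.toTemperedDistribution w)) φ =
          Lp.toTemperedDistribution (hmh.toLp) φ := by
        rw [Lp.fourier_toTemperedDistribution_eq, FourierTransform.fourier_fourierInv_eq]
      rw [TemperedDistribution.fourier_apply, Lp.toTemperedDistribution_apply,
        Lp.toTemperedDistribution_apply] at h1
      simp only [smul_eq_mul] at h1
      rw [h1]
      refine integral_congr_ae ?_
      filter_upwards [hmh.coeFn_toLp] with ξ hξ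
      rw [hξ]
    -- `φ - χφ` vanishes on the ball of radius `R`, so it is an admissible test function in `hu`.
    have hU : ∫ x, 𝓕 (φ - χφ) x * u x = ∫ ξ, φ ξ * (m ξ * h ξ) := by
      have hcs : HasCompactSupport (φ - χφ) := hφ.mono fun x hx h0 => hx (by
        rw [sub_apply, hχφ, h0]; simp)
      have h1 := hu (φ - χφ) hcs (by
        rw [notMem_tsupport_iff_eventuallyEq]
        filter_upwards [Metric.closedBall_mem_nhds 0 hR] with x hx
        rw [sub_apply, hχφ, hχ x (by simpa using hx)]
        simp)
      rw [TemperedDistribution.fourier_apply, Lp.toTemperedDistribution_apply] at h1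
      simp only [smul_eq_mul] at h1
      rw [h1]
      refine integral_congr_ae (Eventually.of_forall fun ξ => ?_)
      simp only [sub_apply, hχφ, m]
      ring
    rw [hK, hw, ← hU, ← integral_sub (hiu _) (hiu _), ← integral_sub]
    · refine integral_eq_zero_of_ae (Eventually.of_forall fun x => ?_)
      have hsub : 𝓕 (φ - χφ) = 𝓕 φ - 𝓕 χφ :=
        map_sub (FourierTransform.fourierCLM ℂ 𝓢(EuclideanSpace ℝ (Fin d), ℂ)) φ χφ
      simp only [hsub, sub_apply, Pi.zero_apply]
      ring
    · exact (hiu _).sub (hiu _)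
    · exact hiu _)
  filter_upwards [hz] with x hx
  simp only [Pi.zero_apply] at hx
  linear_combination hx

end Decomposition

/-! ### Translation invariance of the norms -/

section Translation

open scoped RealInnerProductSpace

variable {d : ℕ} {s : ℝ} {p : ℝ≥0∞} [Fact (1 ≤ p)]

theorem memLp_fourierChar_mul {q : ℝ≥0∞} (a : EuclideanSpace ℝ (Fin d))
    (h : Lp ℂ q (volume : Measure (EuclideanSpace ℝ (Fin d)))) :
    MemLp (fun ξ => ((Real.fourierChar ⟪a, ξ⟫ : Circle) : ℂ) * h ξ) q volume := by
  have hc : Continuous fun ξ : EuclideanSpace ℝ (Fin d) => ((Real.fourierChar ⟪a, ξ⟫ : Circle) : ℂ) :=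
    continuous_induced_dom.comp (Real.continuous_fourierChar.comp (by fun_prop))
  exact memLp_bdd_mul hc.aestronglyMeasurable (c := 1) (fun ξ => (Circle.norm_coe _).le) (Lp.memLp h)

/-- Moved to the test function, the translation becomes a modulation, which does not enlarge the
support and so keeps it away from `0`. -/
theorem IsWeightedFourier.translate
    {u : Lp ℂ p (volume : Measure (EuclideanSpace ℝ (Fin d)))}
    {h : Lp ℂ 2 (volume : Measure (EuclideanSpace ℝ (Fin d)))}
    (hu : IsWeightedFourier s u h) (a : EuclideanSpace ℝ (Fin d)) :
    IsWeightedFourier s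
      (Lp.compMeasurePreserving (fun y => y + a) (measurePreserving_add_right volume a) u)
      (memLp_fourierChar_mul a h).toLp := by
  intro φ hφ h0
  have hsub : Function.support (SchwartzMap.modulate a φ) ⊆ Function.support φ := fun x hx hx0 =>
    hx (by rw [SchwartzMap.modulate_apply, hx0, smul_zero])
  have h1 := hu (SchwartzMap.modulate a φ) (hφ.mono hsub) fun hx => h0 (closure_mono hsub hx)
  rw [TemperedDistribution.fourier_apply, Lp.toTemperedDistribution_apply] at h1 ⊢
  simp only [SchwartzMap.fourier_modulate_apply, SchwartzMap.modulate_apply] at h1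
  have h2 : ∫ y, 𝓕 φ y •
      (Lp.compMeasurePreserving (fun y => y + a) (measurePreserving_add_right volume a) u) y =
      ∫ y, 𝓕 φ y • u (y + a) := by
    refine integral_congr_ae ?_
    filter_upwards [Lp.coeFn_compMeasurePreserving u (measurePreserving_add_right volume a)]
      with y hy
    rw [hy, Function.comp_apply]
  rw [h2, ← integral_sub_right_eq_self (fun y => 𝓕 φ y • u (y + a)) a]
  simp only [sub_add_cancel]
  rw [h1]
  refine integral_congr_ae ?_
  filter_upwards [(memLp_fourierChar_mul a h).coeFn_toLp] with ξ hξ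
  rw [hξ, Circle.smul_def, smul_eq_mul]
  ring

theorem norm_fourierChar_mul_le (a : EuclideanSpace ℝ (Fin d)) {q : ℝ≥0∞}
    (h : Lp ℂ q (volume : Measure (EuclideanSpace ℝ (Fin d)))) :
    ‖(memLp_fourierChar_mul a h).toLp‖ ≤ ‖h‖ := by
  have := norm_toLp_mul_le (c := 1) (fun ξ => (Circle.norm_coe _).le) (memLp_fourierChar_mul a h)
  rwa [one_mul] at this

/-- The translate `u(· + a)`. -/
noncomputable def HdotLp.translate (u : HdotLp d s p) (a : EuclideanSpace ℝ (Fin d)) :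
    HdotLp d s p :=
  ⟨Lp.compMeasurePreserving (fun y => y + a) (measurePreserving_add_right volume a) u.toLp,
    u.2.imp' (fun h => (memLp_fourierChar_mul a h).toLp) fun _ h => h.translate a⟩

theorem HdotLp.coeFn_translate (u : HdotLp d s p) (a : EuclideanSpace ℝ (Fin d)) :
    (u.translate a).toLp =ᵐ[volume] fun y => u.toLp (y + a) :=
  Lp.coeFn_compMeasurePreserving u.toLp (measurePreserving_add_right volume a)

theorem HdotLp.norm_toLp_translate (u : HdotLp d s p) (a : EuclideanSpace ℝ (Fin d)) :
    ‖(u.translate a).toLp‖ = ‖u.toLp‖ :=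
  Lp.norm_compMeasurePreserving u.toLp (measurePreserving_add_right volume a)

theorem HdotLp.norm_weightedFourier_translate_le [NeZero d] (u : HdotLp d s p)
    (a : EuclideanSpace ℝ (Fin d)) :
    ‖(u.translate a).weightedFourier‖ ≤ ‖u.weightedFourier‖ := by
  rw [(u.translate a).isWeightedFourier.unique (u.isWeightedFourier.translate a)]
  exact norm_fourierChar_mul_le a _

end Translation

/-! ### Weak compactness in `Ḣ^s ∩ L^p` -/

section WeakLimits

variable {d : ℕ} {s : ℝ} {p : ℝ≥0∞} [hp1 : Fact (1 ≤ p)]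

theorem exists_functional_eq_integral {α : Type*} [MeasurableSpace α] {μ : Measure α} {b : α → ℂ}
    (hb : MemLp b p.conjExponent μ) :
    ∃ L : Lp ℂ p μ →L[ℂ] ℂ, ∀ f, L f = ∫ x, b x * f x ∂μ := by
  have hpq : p.HolderConjugate p.conjExponent := ENNReal.HolderConjugate.conjExponent hp1.out
  have := hpq.symm
  have : Fact (1 ≤ p.conjExponent) := ⟨ENNReal.HolderConjugate.one_le _ p⟩
  refine ⟨(ContinuousLinearMap.mul ℂ ℂ).lpPairing μ p.conjExponent p hb.toLp, fun f => ?_⟩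
  rw [ContinuousLinearMap.lpPairing_eq_integral]
  refine integral_congr_ae ?_
  filter_upwards [hb.coeFn_toLp] with x hx
  rw [hx, ContinuousLinearMap.mul_apply']

theorem memLp_weight_mul {q : ℝ≥0∞} (s : ℝ) (φ : 𝓢(EuclideanSpace ℝ (Fin d), ℂ))
    (hc : HasCompactSupport φ) (h0 : (0 : EuclideanSpace ℝ (Fin d)) ∉ tsupport φ) :
    MemLp (fun ξ => (((2 * Real.pi * ‖ξ‖) ^ (-s) : ℝ) : ℂ) * φ ξ) q volume := by
  refine Continuous.memLp_of_hasCompactSupport (continuous_of_tsupport fun x hx => ?_) hc.mul_left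
  have hx' : x ∈ tsupport φ := closure_mono (Function.support_mul_subset_right _ _) hx
  have hx0 : x ≠ 0 := fun hx0 => h0 (hx0 ▸ hx')
  have hpos : 2 * Real.pi * ‖x‖ ≠ 0 := by
    have := norm_pos_iff.mpr hx0
    positivity
  refine ContinuousAt.mul ?_ φ.continuous.continuousAt
  exact Complex.continuous_ofReal.continuousAt.comp
    (ContinuousAt.rpow_const (by fun_prop) (Or.inl hpos))

/-- For fixed `φ` both sides of the relation are continuous functionals: `𝓕 φ` lies in the conjugate
space of `L^p`, and the weight times `φ` lies in `L²` because `φ` vanishes near `0`. -/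
theorem IsWeightedFourier.of_tendsto_weak {ι : Type*} {l : Filter ι} [l.NeBot]
    {f : ι → Lp ℂ p (volume : Measure (EuclideanSpace ℝ (Fin d)))}
    {h : ι → Lp ℂ 2 (volume : Measure (EuclideanSpace ℝ (Fin d)))}
    {f' : Lp ℂ p (volume : Measure (EuclideanSpace ℝ (Fin d)))}
    {h' : Lp ℂ 2 (volume : Measure (EuclideanSpace ℝ (Fin d)))}
    (hfh : ∀ i, IsWeightedFourier s (f i) (h i))
    (hf : ∀ L : Lp ℂ p (volume : Measure (EuclideanSpace ℝ (Fin d))) →L[ℂ] ℂ,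
      Tendsto (fun i => L (f i)) l (𝓝 (L f')))
    (hh : ∀ L : Lp ℂ 2 (volume : Measure (EuclideanSpace ℝ (Fin d))) →L[ℂ] ℂ,
      Tendsto (fun i => L (h i)) l (𝓝 (L h'))) :
    IsWeightedFourier s f' h' := by
  intro φ hφ h0
  obtain ⟨L₁, hL₁⟩ := exists_functional_eq_integral (p := p)
    ((𝓕 φ).memLp p.conjExponent (volume : Measure (EuclideanSpace ℝ (Fin d))))
  obtain ⟨L₂, hL₂⟩ := exists_functional_eq_integral (p := 2) (memLp_weight_mul s φ hφ h0)
  have e : ∀ g : Lp ℂ p (volume : Measure (EuclideanSpace ℝ (Fin d))),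
      (𝓕 (Lp.toTemperedDistribution g)) φ = L₁ g := fun g => by
    rw [hL₁, TemperedDistribution.fourier_apply, Lp.toTemperedDistribution_apply]
    rfl
  rw [e, ← hL₂]
  refine tendsto_nhds_unique (hf L₁) ((hh L₂).congr fun i => ?_)
  rw [hL₂, ← hfh i φ hφ h0, e]

/-- A functional on a space normed by `‖A x‖ + ‖B x‖` is a sum of functionals of `A x` and
`B x`. -/
theorem exists_dual_add_of_norm_le {X E F : Type*} [NormedAddCommGroup X] [NormedSpace ℂ X]
    [NormedAddCommGroup E] [NormedSpace ℂ E] [NormedAddCommGroup F] [NormedSpace ℂ F]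
    (A : X →ₗ[ℂ] E) (B : X →ₗ[ℂ] F) (hAB : ∀ x, ‖x‖ ≤ ‖A x‖ + ‖B x‖)
    (hB : Function.Injective B) (Λ : X →L[ℂ] ℂ) :
    ∃ (g₁ : E →L[ℂ] ℂ) (g₂ : F →L[ℂ] ℂ), ∀ x, Λ x = g₁ (A x) + g₂ (B x) := by
  have hΦ : Function.Injective (A.prod B) := fun a b hab => hB (congrArg Prod.snd hab)
  let e := LinearEquiv.ofInjective (A.prod B) hΦ
  -- Hahn–Banach on the image of `X` in `E × F`; the factor `2` compares the sum norm with the max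
  -- norm of the product.
  let Λ₀ : StrongDual ℂ (LinearMap.range (A.prod B)) :=
    (Λ.toLinearMap ∘ₗ e.symm.toLinearMap).mkContinuous (‖Λ‖ * 2) fun y => by
      have h1 : A.prod B (e.symm y) = y := congrArg Subtype.val (e.apply_symm_apply y)
      have h3 : ‖y‖ = max ‖A (e.symm y)‖ ‖B (e.symm y)‖ := by
        rw [← Submodule.norm_coe, ← h1]
        rfl
      have h2 : ‖e.symm y‖ ≤ 2 * ‖y‖ := by
        refine (hAB _).trans ?_
        rw [h3, two_mul]
        exact add_le_add (le_max_left _ _) (le_max_right _ _)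
      calc ‖Λ (e.symm y)‖ ≤ ‖Λ‖ * ‖e.symm y‖ := Λ.le_opNorm _
        _ ≤ ‖Λ‖ * (2 * ‖y‖) := by gcongr
        _ = ‖Λ‖ * 2 * ‖y‖ := by ring
  obtain ⟨g, hg, -⟩ := exists_extension_norm_eq _ Λ₀
  refine ⟨g ∘L ContinuousLinearMap.inl ℂ E F, g ∘L ContinuousLinearMap.inr ℂ E F, fun x => ?_⟩
  have h1 : g (A x, B x) = Λ₀ (e x) := hg (e x)
  have h2 : Λ₀ (e x) = Λ x := congrArg Λ (e.symm_apply_apply x)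
  rw [← h2, ← h1, ContinuousLinearMap.comp_apply, ContinuousLinearMap.comp_apply, ← map_add]
  congr 1
  simp

theorem HdotLp.tendsto_toWeakSpace [NeZero d] {ι : Type*} {l : Filter ι}
    {v : ι → HdotLp d s p} {w : HdotLp d s p}
    (hf : ∀ L : Lp ℂ p (volume : Measure (EuclideanSpace ℝ (Fin d))) →L[ℂ] ℂ,
      Tendsto (fun i => L (v i).toLp) l (𝓝 (L w.toLp)))
    (hh : ∀ L : Lp ℂ 2 (volume : Measure (EuclideanSpace ℝ (Fin d))) →L[ℂ] ℂ,
      Tendsto (fun i => L (v i).weightedFourier) l (𝓝 (L w.weightedFourier))) :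
    Tendsto (fun i => toWeakSpace ℂ (HdotLp d s p) (v i)) l (𝓝 (toWeakSpace ℂ _ w)) := by
  have hinj : Function.Injective (topDualPairing ℂ (HdotLp d s p)).flip := fun a b hab =>
    (SeparatingDual.eq_iff_forall_dual_eq (R := ℂ)).mpr fun g => LinearMap.congr_fun hab g
  refine (WeakBilin.tendsto_iff_forall_eval_tendsto _ hinj).mpr fun Λ => ?_
  obtain ⟨g₁, g₂, hg⟩ := exists_dual_add_of_norm_le weightedFourier toLp
    (fun a : HdotLp d s p => (norm_def a).le) toLp_injective Λ
  change Tendsto (fun i => Λ (v i)) l (𝓝 (Λ w))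
  simp_rw [hg]
  exact (hh _).add (hf _)

/-- Bounded sequences in `Ḣ^s ∩ L^p`, `1 < p < ∞`, have weakly convergent subsequences. -/
theorem HdotLp.exists_subseq_tendsto_weak [NeZero d] (hp : 1 < p) (hp' : p < ⊤)
    (v : ℕ → HdotLp d s p) {C : ℝ}
    (hv : ∀ n, ‖(v n).weightedFourier‖ ≤ C) (hv' : ∀ n, ‖(v n).toLp‖ ≤ C) :
    ∃ w : HdotLp d s p, ∃ k : ℕ → ℕ, StrictMono k ∧
      (∀ L : Lp ℂ p (volume : Measure (EuclideanSpace ℝ (Fin d))) →L[ℂ] ℂ,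
        Tendsto (fun j => L (v (k j)).toLp) atTop (𝓝 (L w.toLp))) ∧
      Tendsto (fun j => toWeakSpace ℂ (HdotLp d s p) (v (k j))) atTop
        (𝓝 (toWeakSpace ℂ _ w)) := by
  obtain ⟨f, k₁, hk₁, hf⟩ := exists_subseq_tendsto_weak_Lp hp hp'.ne (fun n => (v n).toLp) hv'
  obtain ⟨h, k₂, hk₂, hh⟩ := exists_subseq_tendsto_weak_Lp ENNReal.one_lt_two ENNReal.ofNat_ne_top
    (fun n => (v (k₁ n)).weightedFourier) fun n => hv _
  have hf' : ∀ L : Lp ℂ p (volume : Measure (EuclideanSpace ℝ (Fin d))) →L[ℂ] ℂ,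
      Tendsto (fun j => L (v (k₁ (k₂ j))).toLp) atTop (𝓝 (L f)) :=
    fun L => (hf L).comp hk₂.tendsto_atTop
  have hfh : IsWeightedFourier s f h :=
    IsWeightedFourier.of_tendsto_weak (fun j => (v (k₁ (k₂ j))).isWeightedFourier) hf' hh
  let w : HdotLp d s p := ⟨f, h, hfh⟩
  -- `weightedFourier` is defined by choice, so uniqueness is needed to recognise the weak limit
  -- `h`.
  have hw : w.weightedFourier = h := w.isWeightedFourier.unique hfh
  refine ⟨w, k₁ ∘ k₂, hk₁.comp hk₂, hf', tendsto_toWeakSpace hf' fun L => ?_⟩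
  rw [hw]
  exact hh L

end WeakLimits

/-! ### Nonvanishing of the weak limit -/

section Main

variable {d : ℕ} {s : ℝ} {p : ℝ≥0∞} [Fact (1 ≤ p)]

/-- The left-hand side is the Chebyshev bound for the set where the high-frequency part reaches
`η/2`; it depends on the sequence only through `C`. -/
theorem exists_cutoff_scale (hs : 0 < s) (C : ℝ) {η : ℝ} (hη : 0 < η) {δ : ℝ≥0∞} (hδ : 0 < δ) :
    ∃ R : ℝ, 0 < R ∧
      (ENNReal.ofReal (η / 2))⁻¹ ^ 2 * ENNReal.ofReal ((2 * Real.pi * R) ^ (-s) * C) ^ 2 < δ := by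
  have h1 : Tendsto (fun R : ℝ => (2 * Real.pi * R) ^ (-s) * C) atTop (𝓝 0) := by
    have := ((tendsto_rpow_neg_atTop hs).comp
      (tendsto_id.const_mul_atTop Real.two_pi_pos)).mul_const C
    simpa [Function.comp_def] using! this
  have h2 : Tendsto (fun R : ℝ => (ENNReal.ofReal (η / 2))⁻¹ ^ 2 *
      ENNReal.ofReal ((2 * Real.pi * R) ^ (-s) * C) ^ 2) atTop (𝓝 0) := by
    have hne : (ENNReal.ofReal (η / 2))⁻¹ ^ 2 ≠ ∞ :=
      ENNReal.pow_ne_top (ENNReal.inv_ne_top.mpr (ENNReal.ofReal_pos.mpr (half_pos hη)).ne')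
    have := ENNReal.Tendsto.const_mul
      ((ENNReal.continuous_pow 2).tendsto _ |>.comp (ENNReal.tendsto_ofReal h1)) (Or.inr hne)
    simpa [Function.comp_def] using! this
  exact ((eventually_gt_atTop 0).and (h2.eventually_lt_const hδ)).exists

/-- A lower bound on the size of a level set forces a low-frequency average to be large
somewhere. -/
theorem IsWeightedFourier.exists_lt_norm_integral
    {u : Lp ℂ p (volume : Measure (EuclideanSpace ℝ (Fin d)))}
    {h : Lp ℂ 2 (volume : Measure (EuclideanSpace ℝ (Fin d)))}
    (hu : IsWeightedFourier s u h) (hs : 0 < s)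
    {R C η : ℝ} (hR : 0 < R) {χ : 𝓢(EuclideanSpace ℝ (Fin d), ℂ)} (hχ : ∀ x, ‖x‖ ≤ R → χ x = 1)
    (hχ1 : ∀ x, ‖1 - χ x‖ ≤ 1) (hC : ‖h‖ ≤ C) (hη : 0 < η)
    (hlt : (ENNReal.ofReal (η / 2))⁻¹ ^ 2 * ENNReal.ofReal ((2 * Real.pi * R) ^ (-s) * C) ^ 2 <
      volume {x | η < ‖u x‖}) :
    ∃ x, η / 2 < ‖∫ y, (𝓕⁻ χ) (x - y) * u y‖ := by
  by_contra! hle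
  obtain ⟨w, hw, hae⟩ := hu.exists_high_frequency hs hR hχ hχ1
  refine hlt.not_ge ?_
  -- If the average never exceeds `η/2`, then `|u| > η` forces `|w| ≥ η/2`, and Chebyshev
  -- contradicts `hlt`.
  have h1 : volume {x | η < ‖u x‖} ≤ volume {x | ENNReal.ofReal (η / 2) ≤ ‖w x‖ₑ} := by
    refine measure_mono_ae ?_
    filter_upwards [hae] with x hx hxu
    change ENNReal.ofReal (η / 2) ≤ ‖w x‖ₑ
    rw [← ofReal_norm]
    refine ENNReal.ofReal_le_ofReal ?_
    have h2 : ‖u x‖ ≤ ‖w x‖ + ‖∫ y, (𝓕⁻ χ) (x - y) * u y‖ := by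
      conv_lhs => rw [hx]
      exact norm_add_le _ _
    have h3 : η < ‖u x‖ := hxu
    linarith [hle x]
  have h2 := meas_ge_le_mul_pow_eLpNorm_enorm (p := 2) volume two_ne_zero ENNReal.ofNat_ne_top
    (Lp.memLp w).1 (ε := ENNReal.ofReal (η / 2))
    (ENNReal.ofReal_pos.mpr (half_pos hη)).ne' fun h => absurd h ENNReal.ofReal_ne_top
  refine h1.trans (h2.trans ?_)
  have h3 : eLpNorm w 2 volume ≤ ENNReal.ofReal ((2 * Real.pi * R) ^ (-s) * C) := by
    rw [← Lp.enorm_def, ← ofReal_norm]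
    exact ENNReal.ofReal_le_ofReal (hw.trans (by gcongr))
  simp only [ENNReal.toReal_ofNat, ENNReal.rpow_ofNat]
  gcongr

end Main

theorem lemma1 (d : ℕ) [NeZero d] (s : ℝ) (hs : 0 < s)
    (p : ℝ≥0∞) [Fact (1 ≤ p)] (hp : 1 < p) (hp' : p < ⊤)
    (u : ℕ → HdotLp d s p)
    (hbdd : BddAbove (Set.range fun n => ‖(u n).weightedFourier‖ + ‖(u n).toLp‖))
    (η : ℝ) (hη : 0 < η)
    (hlevel : 0 < ⨅ n, volume {x : EuclideanSpace ℝ (Fin d) | η < ‖(u n).toLp x‖}) :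
    ∃ x : ℕ → EuclideanSpace ℝ (Fin d), ∃ k : ℕ → ℕ, StrictMono k ∧
      ∃ v : ℕ → HdotLp d s p, ∃ w : HdotLp d s p,
        (∀ j, (v j).toLp =ᵐ[volume] fun y => (u (k j)).toLp (y + x (k j))) ∧
        Tendsto (fun j => toWeakSpace ℂ (HdotLp d s p) (v j)) atTop
          (𝓝 (toWeakSpace ℂ (HdotLp d s p) w)) ∧
        w ≠ 0 := by
  obtain ⟨C, hC⟩ := hbdd
  have hC' : ∀ n, ‖(u n).weightedFourier‖ + ‖(u n).toLp‖ ≤ C := fun n => hC ⟨n, rfl⟩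
  have hC₁ : ∀ n, ‖(u n).weightedFourier‖ ≤ C := fun n => by
    linarith [hC' n, norm_nonneg (u n).toLp]
  have hC₂ : ∀ n, ‖(u n).toLp‖ ≤ C := fun n => by
    linarith [hC' n, norm_nonneg (u n).weightedFourier]
  obtain ⟨R, hR, hRlt⟩ := exists_cutoff_scale hs C hη hlevel
  obtain ⟨χ, hχ, hχ1⟩ := exists_cutoff (V := EuclideanSpace ℝ (Fin d)) hR
  -- One `R` and one `χ` serve all `n`, thanks to the uniform bounds; otherwise the averages at the
  -- `x n` would not come from a single functional.
  choose x hx using fun n => (u n).isWeightedFourier.exists_lt_norm_integral hs hR hχ hχ1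
    (hC₁ n) hη (hRlt.trans_le (iInf_le _ n))
  obtain ⟨w, k, hk, hweak, hlim⟩ := HdotLp.exists_subseq_tendsto_weak hp hp'
    (fun n => (u n).translate (x n))
    (fun n => ((u n).norm_weightedFourier_translate_le (x n)).trans (hC₁ n))
    (fun n => ((u n).norm_toLp_translate (x n)).trans_le (hC₂ n))
  refine ⟨x, k, hk, fun j => (u (k j)).translate (x (k j)), w,
    fun j => (u (k j)).coeFn_translate (x (k j)), hlim, fun hw0 => ?_⟩
  -- The kernel `ρ(-y)` whose pairing with the `n`-th translate is `(ρ * u_n)(x_n)`.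
  have hb : MemLp (fun y => (𝓕⁻ χ) (-y)) p.conjExponent
      (volume : Measure (EuclideanSpace ℝ (Fin d))) :=
    ((𝓕⁻ χ).memLp p.conjExponent volume).comp_measurePreserving (Measure.measurePreserving_neg _)
  obtain ⟨L, hL⟩ := exists_functional_eq_integral hb
  have hLv : ∀ n, L ((u n).translate (x n)).toLp = ∫ y, (𝓕⁻ χ) (x n - y) * (u n).toLp y := by
    intro n
    rw [hL, ← integral_add_right_eq_self (fun y => (𝓕⁻ χ : 𝓢(_, ℂ)) (x n - y) * (u n).toLp y) (x n)]
    refine integral_congr_ae ?_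
    filter_upwards [(u n).coeFn_translate (x n)] with y hy
    rw [hy, sub_add_cancel_right]
  have h1 := (hweak L).norm
  rw [hw0, map_zero, map_zero, norm_zero] at h1
  -- These pairings have modulus at least `η/2`, yet tend to `0` if `w = 0`.
  have h2 := ge_of_tendsto' h1 fun j => by
    rw [hLv]
    exact (hx (k j)).le
  linarith
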